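/- Fix an integer $m\ge 2$. For every strictly increasing $m$-tuple of integers $\mathbf i=(i_1<\dots<i_m)$ let $P_{\mathbf i}$ be an indeterminate, extended to all $m$-tuples of integers antisymmetrically (and by $0$ if an entry is repeated). A tuple is called *frozen* if it has the form $(i,i+1,\dots,i+m-1)$. Let $\mathrm{Gr}_m$ be the quotient of the localized polynomial algebra $\mathbb C[P_{\mathbf i},\,P_{\mathbf j}^{-1} : \mathbf i \text{ increasing},\ \mathbf j \text{ frozen}]$ by the ideal generated by the Plücker relations $$\sum_{t=1}^{m+1}(-1)^t\,P_{i_1,\dots,i_{m-1},j_t}\,P_{j_1,\dots,\widehat{j_t},\dots,j_{m+1}}\qquad (i_1<\dots<i_{m-1},\ \ j_1<\dots<j_{m+1}),$$ and let $\overline{\mathrm{Gr}}_m$ be the quotient of $\mathrm{Gr}_m$ by the ideal generated by all $P_{\mathbf j}-1$ with $\mathbf j$ frozen. Let $\mathrm{Gr}_m^N$ (resp. $\mathrm{Gr}_m^+$) be the subalgebra of $\mathrm{Gr}_m$ generated by all $P_{\mathbf i}$ and all inverses $P_{\mathbf j}^{-1}$, $\mathbf j$ frozen, with indices in $[1,N]$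 (resp. $[1,\infty)$), let $\overline{\mathrm{Gr}}{}_m^+$ be the subalgebra of $\overline{\mathrm{Gr}}_m$ generated by the $P_{\mathbf i}$ with indices in $[1,\infty)$, and let $p:\mathrm{Gr}_m^+\to\overline{\mathrm{Gr}}{}_m^+$ be the canonical projection. For $t\in\mathbb Z$ let $\mathrm{sh}_t$ be the automorphism of $\overline{\mathrm{Gr}}_m$ with $P_{\mathbf i}\mapsto P_{\mathbf i+t}$; for $t\ge 0$ it maps $\overline{\mathrm{Gr}}{}_m^+$ into itself. For $N>0$ divisible by $m$ and $V=\mathbb C^m$, let $(V^N)^\circ$ be the set of $N$-tuples $(v_1,\dots,v_N)$ in $V$ in which any $m$ cyclically consecutive vectors are linearly independent, with indices continued by $v_{k+N}=v_k$. For $i\in[1,m-1]$ let $\kappa_i$ be the self-map of $(V^N)^\circ$ that replaces, in every window $[v_{tm+1},\dots,v_{tm+m}]$, the pair $v_{j},v_{j+1}$ with $j=tm+i$ by the pair $v_{j+1},w_{j}$, where $$w_j=\frac{\det(v_j,v_{j+2},\dots,v_{j+m})}{\det(v_{j+1},v_{j+2},\dots,v_{j+m})}\,v_{j+1}-v_j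 .$$ Fraser's action $\tilde\sigma_i^{(m,N)}$ is the pullback of functions on $(V^N)^\circ$ along $\kappa_i$. The algebra $\mathrm{Gr}_m^N$ is identified with an algebra of functions on $(V^N)^\circ$ by $P_{\mathbf i}\mapsto \det(v_{i_1},\dots,v_{i_m})$. **Proposition.** There are $\mathbb C$-algebra endomorphisms $\sigma_i$ of $\overline{\mathrm{Gr}}{}_m^+$, $i\in[1,m-1]$, such that (a) the $\sigma_i$ satisfy the braid relations: $\sigma_i\sigma_{i+1}\sigma_i=\sigma_{i+1}\sigma_i\sigma_{i+1}$ for $1\le i\le m-2$, and $\sigma_i\sigma_j=\sigma_j\sigma_i$ if $|i-j|>1$; (b) $\sigma_i\circ\mathrm{sh}_m=\mathrm{sh}_m\circ\sigma_i$ for all $i$; (c) for every $i$ and every $x\in\mathrm{Gr}_m^+$ there is a positive integer $N$ such that for every $N'\ge N$ with $m\mid N'$ one has $x\in\mathrm{Gr}_m^{N'}$, $\tilde\sigma_i^{(m,N')}(x)\in\mathrm{Gr}_m^{N'}$, and $$\sigma_i(p(x))=p\bigl(\tilde\sigma_i^{(m,N')}(x)\bigr).$$ Moreover, each $\sigma_i$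 extends to a $\mathbb C$-algebra endomorphism of $\overline{\mathrm{Gr}}_m$, again denoted by $\sigma_i$, such that for every $x\in\overline{\mathrm{Gr}}_m$ and all sufficiently large $t$ one has $\mathrm{sh}_{mt}(x)\in\overline{\mathrm{Gr}}{}_m^+$ and $\sigma_i(x)=\mathrm{sh}_{-mt}\bigl(\sigma_i(\mathrm{sh}_{mt}(x))\bigr)$; these extensions also satisfy the braid relations and commute with $\mathrm{sh}_m$. -/

import Mathlib

namespace InfGrass

noncomputable section

/-! ### Index sets and Plücker symbols -/

/-- Strictly increasing `m`-tuples of integers `i₁ < ⋯ < i_m`. -/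
abbrev Idx (m : ℕ) : Type := Fin m ↪o ℤ

/-- The tuple consists of consecutive integers `(i, i+1, …, i+m-1)`. -/
def IsFrozen {m : ℕ} (I : Idx m) : Prop := ∃ a : ℤ, ∀ k : Fin m, I k = a + (k : ℤ)

/-- The translate `I + t` of an increasing tuple. -/
def Idx.shift {m : ℕ} (t : ℤ) (I : Idx m) : Idx m :=
  OrderEmbedding.ofStrictMono (fun k => I k + t)
    (fun _ _ h => add_lt_add_left (I.strictMono h) t)

/-- The increasing rearrangement of a tuple of pairwise distinct integers. -/
def sortIdx {m : ℕ} (f : Fin m → ℤ) (hf : Function.Injective f) : Idx m :=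
  OrderEmbedding.ofStrictMono (f ∘ Tuple.sort f)
    ((Tuple.monotone_sort f).strictMono_of_injective (hf.comp (Tuple.sort f).injective))

open Classical in
/-- The antisymmetric extension of a family of symbols `x_I` (`I` increasing) to all tuples of
integers: permuting the entries changes the symbol by the sign of the permutation, and a tuple
with a repeated entry gives `0`. -/
def altExt {m : ℕ} {A : Type*} [CommRing A] (x : Idx m → A) (f : Fin m → ℤ) : A :=
  if hf : Function.Injective f then
    ((Equiv.Perm.sign (Tuple.sort f) : ℤ) : A) * x (sortIdx f hf)
  else 0

/-- The tuple `(i₁, …, i_{m-1}, j)`. -/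
def appendLast {m : ℕ} (i : Fin (m - 1) → ℤ) (j : ℤ) : Fin m → ℤ :=
  fun k => if h : (k : ℕ) < m - 1 then i ⟨k, h⟩ else j

/-- The Plücker expression
`∑_{t=1}^{m+1} (-1)^t P_{i₁,…,i_{m-1},j_t} P_{j₁,…,ĵ_t,…,j_{m+1}}` in a family of symbols
(the index `t` of the code starts from `0`). -/
def pluckerExpr {m : ℕ} {A : Type*} [CommRing A] (x : Idx m → A)
    (i : Fin (m - 1) ↪o ℤ) (j : Fin (m + 1) ↪o ℤ) : A :=
  ∑ t : Fin (m + 1), (-1) ^ ((t : ℕ) + 1) *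
    (altExt x (appendLast i (j t)) * altExt x (fun k : Fin m => j (t.succAbove k)))

/-! ### The algebras -/

/-- The multiplicative set generated by the variables indexed by consecutive tuples. -/
def frozenMonoid (m : ℕ) : Submonoid (MvPolynomial (Idx m) ℂ) :=
  Submonoid.closure {q | ∃ I : Idx m, IsFrozen I ∧ q = MvPolynomial.X I}

/-- The localized polynomial algebra `ℂ[P_I, P_J⁻¹]`, `I` increasing, `J` consecutive. -/
def LocPoly (m : ℕ) : Type := Localization (frozenMonoid m)

instance (m : ℕ) : CommRing (LocPoly m) :=
  inferInstanceAs (CommRing (Localization (frozenMonoid m)))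

instance (m : ℕ) : Algebra (MvPolynomial (Idx m) ℂ) (LocPoly m) :=
  inferInstanceAs (Algebra (MvPolynomial (Idx m) ℂ) (Localization (frozenMonoid m)))

instance (m : ℕ) : Algebra ℂ (LocPoly m) :=
  inferInstanceAs (Algebra ℂ (Localization (frozenMonoid m)))

instance (m : ℕ) : IsScalarTower ℂ (MvPolynomial (Idx m) ℂ) (LocPoly m) :=
  inferInstanceAs (IsScalarTower ℂ (MvPolynomial (Idx m) ℂ) (Localization (frozenMonoid m)))

instance (m : ℕ) : IsLocalization (frozenMonoid m) (LocPoly m) :=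
  inferInstanceAs (IsLocalization (frozenMonoid m) (Localization (frozenMonoid m)))

/-- The variable `P_I` in the localized polynomial algebra. -/
def locP {m : ℕ} (I : Idx m) : LocPoly m :=
  algebraMap (MvPolynomial (Idx m) ℂ) (LocPoly m) (MvPolynomial.X I)

/-- The ideal generated by all Plücker relations. -/
def pluckerIdeal (m : ℕ) : Ideal (LocPoly m) :=
  Ideal.span {r | ∃ (i : Fin (m - 1) ↪o ℤ) (j : Fin (m + 1) ↪o ℤ), r = pluckerExpr locP i j}

/-- The algebra `Gr_m`. -/
abbrev Gr (m : ℕ) : Type := LocPoly m ⧸ pluckerIdeal m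

/-- The element `P_I` of `Gr_m`. -/
def P {m : ℕ} (I : Idx m) : Gr m := Ideal.Quotient.mkₐ ℂ (pluckerIdeal m) (locP I)

/-- The ideal generated by `P_I - 1` for all consecutive tuples `I`. -/
def frozenIdeal (m : ℕ) : Ideal (Gr m) :=
  Ideal.span {r | ∃ I : Idx m, IsFrozen I ∧ r = P I - 1}

/-- The algebra `\bar Gr_m`, in which all `P_I` with `I` consecutive are set to `1`. -/
abbrev GrBar (m : ℕ) : Type := Gr m ⧸ frozenIdeal m

/-- The canonical projection `Gr_m → \bar Gr_m`. -/
def proj (m : ℕ) : Gr m →ₐ[ℂ] GrBar m := Ideal.Quotient.mkₐ ℂ (frozenIdeal m)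

/-- For a set `S` of integers (an interval in practice), the subalgebra of `Gr_m` generated by all
`P_I` with `I ⊆ S` and all inverses `P_J⁻¹` with `J ⊆ S` consecutive. -/
def GrOn (m : ℕ) (S : Set ℤ) : Subalgebra ℂ (Gr m) :=
  Algebra.adjoin ℂ ({y | ∃ I : Idx m, (∀ k, I k ∈ S) ∧ y = P I} ∪
    {y | ∃ J : Idx m, IsFrozen J ∧ (∀ k, J k ∈ S) ∧ y * P J = 1})

/-- For a set `S` of integers, the subalgebra of `\bar Gr_m` generated by all `P_I`, `I ⊆ S`. -/
def GrBarOn (m : ℕ) (S : Set ℤ) : Subalgebra ℂ (GrBar m) :=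
  Algebra.adjoin ℂ {y | ∃ I : Idx m, (∀ k, I k ∈ S) ∧ y = proj m (P I)}

/-- `Gr_m^N`, the subalgebra belonging to the interval `[1, N]`. -/
abbrev GrN (m N : ℕ) : Subalgebra ℂ (Gr m) := GrOn m (Set.Icc 1 (N : ℤ))

/-- `Gr_m^+`, the subalgebra belonging to the interval `[1, ∞)`. -/
abbrev GrPlus (m : ℕ) : Subalgebra ℂ (Gr m) := GrOn m (Set.Ici 1)

/-- `\bar Gr_m^+`, the subalgebra belonging to the interval `[1, ∞)`. -/
abbrev GrBarPlus (m : ℕ) : Subalgebra ℂ (GrBar m) := GrBarOn m (Set.Ici 1)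

lemma proj_eq_one {m : ℕ} {I : Idx m} (hI : IsFrozen I) : proj m (P I) = 1 := by
  have h : P I - 1 ∈ frozenIdeal m := Ideal.subset_span ⟨I, hI, rfl⟩
  have h2 : proj m (P I - 1) = 0 := Ideal.Quotient.eq_zero_iff_mem.mpr h
  rw [map_sub, map_one, sub_eq_zero] at h2
  exact h2

lemma proj_mem {m : ℕ} {S : Set ℤ} {x : Gr m} (hx : x ∈ GrOn m S) :
    proj m x ∈ GrBarOn m S := by
  suffices h : GrOn m S ≤ (GrBarOn m S).comap (proj m) from h hx
  refine Algebra.adjoin_le ?_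
  rintro y (⟨I, hI, rfl⟩ | ⟨J, hJ, -, hy⟩)
  · exact Algebra.subset_adjoin ⟨I, hI, rfl⟩
  · have h1 : proj m y = 1 := by
      have h2 := congrArg (proj m) hy
      rwa [map_mul, map_one, proj_eq_one hJ, mul_one] at h2
    change proj m y ∈ GrBarOn m S
    rw [h1]
    exact one_mem _

/-- The canonical projection `p : Gr_m^+ → \bar Gr_m^+`. -/
def projPlus (m : ℕ) : GrPlus m →ₐ[ℂ] GrBarPlus m :=
  ((proj m).comp (GrPlus m).val).codRestrict (GrBarPlus m) (fun x => proj_mem x.2)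

/-! ### The shifts -/

lemma shift_isFrozen {m : ℕ} (t : ℤ) {I : Idx m} (hI : IsFrozen I) : IsFrozen (I.shift t) := by
  obtain ⟨a, ha⟩ := hI
  refine ⟨a + t, fun k => ?_⟩
  have h : (I.shift t) k = I k + t := rfl
  rw [h, ha]
  ring

lemma sort_add {m : ℕ} (f : Fin m → ℤ) (t : ℤ) :
    Tuple.sort (fun k => f k + t) = Tuple.sort f := by
  symm
  rw [Tuple.eq_sort_iff]
  obtain ⟨h1, h2⟩ := (Tuple.eq_sort_iff (f := f) (σ := Tuple.sort f)).mp rfl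
  refine ⟨fun i j hij => ?_, fun i j hij h => h2 i j hij ?_⟩
  · exact add_le_add_left (h1 hij) t
  · exact add_right_cancel h

lemma altExt_shift {m : ℕ} {A : Type*} [CommRing A] (x : Idx m → A) (t : ℤ) (f : Fin m → ℤ) :
    altExt (fun I => x (I.shift t)) f = altExt x (fun k => f k + t) := by
  unfold altExt
  by_cases hf : Function.Injective f
  · have hf' : Function.Injective (fun k => f k + t) := fun a b h => hf (add_right_cancel h)
    have h3 : (sortIdx f hf).shift t = sortIdx (fun k => f k + t) hf' := by
      ext k
      change f (Tuple.sort f k) + t = f (Tuple.sort (fun k => f k + t) k) + t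
      rw [sort_add]
    rw [dif_pos hf, dif_pos hf', sort_add, ← h3]
  · have hf' : ¬ Function.Injective (fun k => f k + t) :=
      fun h => hf (fun a b hab => h (by simp only [hab]))
    rw [dif_neg hf, dif_neg hf']

lemma altExt_map {m : ℕ} {A B : Type*} [CommRing A] [CommRing B] (φ : A →+* B)
    (x : Idx m → A) (f : Fin m → ℤ) : φ (altExt x f) = altExt (fun I => φ (x I)) f := by
  unfold altExt
  split_ifs <;> simp

lemma pluckerExpr_map {m : ℕ} {A B : Type*} [CommRing A] [CommRing B] (φ : A →+* B)
    (x : Idx m → A) (i : Fin (m - 1) ↪o ℤ) (j : Fin (m + 1) ↪o ℤ) :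
    φ (pluckerExpr x i j) = pluckerExpr (fun I => φ (x I)) i j := by
  simp [pluckerExpr, altExt_map]

lemma pluckerExpr_shift {m : ℕ} {A : Type*} [CommRing A] (x : Idx m → A) (t : ℤ)
    (i : Fin (m - 1) ↪o ℤ) (j : Fin (m + 1) ↪o ℤ) :
    pluckerExpr (fun I => x (I.shift t)) i j =
      pluckerExpr x (Idx.shift t i) (Idx.shift t j) := by
  unfold pluckerExpr
  refine Finset.sum_congr rfl fun s _ => ?_
  rw [altExt_shift, altExt_shift]
  congr 3
  funext k
  unfold appendLast
  split_ifs <;> rfl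

/-- The universal property of `ℂ[P_I, P_J⁻¹]`: a family of elements of an algebra whose members
with consecutive index are invertible extends to an algebra homomorphism. -/
def locLift {m : ℕ} {A : Type*} [CommRing A] [Algebra ℂ A] (x : Idx m → A)
    (hx : ∀ I, IsFrozen I → IsUnit (x I)) : LocPoly m →ₐ[ℂ] A :=
  IsLocalization.liftAlgHom (M := frozenMonoid m) (f := MvPolynomial.aeval x) (by
    rintro ⟨y, hy⟩
    change IsUnit (MvPolynomial.aeval x y)
    refine Submonoid.closure_induction (motive := fun y _ => IsUnit (MvPolynomial.aeval x y))
      ?_ ?_ ?_ hy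
    · rintro _ ⟨I, hI, rfl⟩
      rw [MvPolynomial.aeval_X]
      exact hx I hI
    · rw [map_one]
      exact isUnit_one
    · intro a b _ _ ha hb
      rw [map_mul]
      exact ha.mul hb)

lemma locLift_locP {m : ℕ} {A : Type*} [CommRing A] [Algebra ℂ A] (x : Idx m → A)
    (hx : ∀ I, IsFrozen I → IsUnit (x I)) (I : Idx m) : locLift x hx (locP I) = x I := by
  simp [locLift, locP]

/-- The universal property of `Gr_m`: if moreover the family satisfies all Plücker relations,
then `P_I ↦ x_I` defines an algebra homomorphism on `Gr_m`. -/
def grLift {m : ℕ} {A : Type*} [CommRing A] [Algebra ℂ A] (x : Idx m → A)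
    (hx : ∀ I, IsFrozen I → IsUnit (x I)) (hP : ∀ i j, pluckerExpr x i j = 0) : Gr m →ₐ[ℂ] A :=
  Ideal.Quotient.liftₐ (pluckerIdeal m) (locLift x hx) (by
    suffices h : pluckerIdeal m ≤ RingHom.ker (locLift x hx) from fun a ha => h ha
    refine Ideal.span_le.mpr ?_
    rintro _ ⟨i, j, rfl⟩
    change (locLift x hx : LocPoly m →+* A) (pluckerExpr locP i j) = 0
    rw [pluckerExpr_map]
    have h : (fun I => (locLift x hx : LocPoly m →+* A) (locP I)) = x :=
      funext fun I => locLift_locP x hx I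
    rw [h, hP])

lemma grLift_P {m : ℕ} {A : Type*} [CommRing A] [Algebra ℂ A] (x : Idx m → A)
    (hx : ∀ I, IsFrozen I → IsUnit (x I)) (hP : ∀ i j, pluckerExpr x i j = 0) (I : Idx m) :
    grLift x hx hP (P I) = x I :=
  locLift_locP x hx I

lemma isUnit_P {m : ℕ} {I : Idx m} (hI : IsFrozen I) : IsUnit (P I) := by
  have h : IsUnit (locP I) :=
    IsLocalization.map_units (LocPoly m)
      (⟨MvPolynomial.X I, Submonoid.subset_closure ⟨I, hI, rfl⟩⟩ : frozenMonoid m)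
  exact h.map (Ideal.Quotient.mkₐ ℂ (pluckerIdeal m))

lemma pluckerExpr_P {m : ℕ} (i : Fin (m - 1) ↪o ℤ) (j : Fin (m + 1) ↪o ℤ) :
    pluckerExpr (P (m := m)) i j = 0 := by
  have h := pluckerExpr_map (Ideal.Quotient.mk (pluckerIdeal m)) locP i j
  have h1 : pluckerExpr locP i j ∈ pluckerIdeal m := Ideal.subset_span ⟨i, j, rfl⟩
  rw [Ideal.Quotient.eq_zero_iff_mem.mpr h1] at h
  exact h.symm

/-- The shift `sh_t : Gr_m → Gr_m`, `P_I ↦ P_{I+t}`. -/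
def sh (m : ℕ) (t : ℤ) : Gr m →ₐ[ℂ] Gr m :=
  grLift (fun I => P (I.shift t)) (fun _ hI => isUnit_P (shift_isFrozen t hI))
    (fun i j => by rw [pluckerExpr_shift, pluckerExpr_P])

lemma sh_P {m : ℕ} (t : ℤ) (I : Idx m) : sh m t (P I) = P (I.shift t) := grLift_P _ _ _ I

/-- The shift `sh_t` on `\bar Gr_m`. -/
def shBar (m : ℕ) (t : ℤ) : GrBar m →ₐ[ℂ] GrBar m :=
  Ideal.Quotient.liftₐ (frozenIdeal m) ((proj m).comp (sh m t)) (by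
    suffices h : frozenIdeal m ≤ RingHom.ker ((proj m).comp (sh m t)) from fun a ha => h ha
    refine Ideal.span_le.mpr ?_
    rintro _ ⟨I, hI, rfl⟩
    change proj m (sh m t (P I - 1)) = 0
    rw [map_sub, map_sub, map_one, map_one, sh_P, proj_eq_one (shift_isFrozen t hI), sub_self])

lemma shBar_P {m : ℕ} (t : ℤ) (I : Idx m) :
    shBar m t (proj m (P I)) = proj m (P (I.shift t)) := by
  change proj m (sh m t (P I)) = _
  rw [sh_P]

lemma shBar_mem {m : ℕ} (t : ℕ) {x : GrBar m} (hx : x ∈ GrBarPlus m) :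
    shBar m t x ∈ GrBarPlus m := by
  suffices h : GrBarPlus m ≤ (GrBarPlus m).comap (shBar m t) from h hx
  refine Algebra.adjoin_le ?_
  rintro y ⟨I, hI, rfl⟩
  change shBar m t (proj m (P I)) ∈ GrBarPlus m
  rw [shBar_P]
  refine Algebra.subset_adjoin ⟨I.shift t, fun k => ?_, rfl⟩
  have h1 : (1 : ℤ) ≤ I k := hI k
  change (1 : ℤ) ≤ I k + t
  omega

/-- The shift `sh_t`, `t ≥ 0`, as an endomorphism of `\bar Gr_m^+`. -/
def shPlus (m t : ℕ) : GrBarPlus m →ₐ[ℂ] GrBarPlus m :=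
  ((shBar m t).comp (GrBarPlus m).val).codRestrict (GrBarPlus m) (fun x => shBar_mem t x.2)

/-! ### Configurations of vectors and coordinate functions -/

/-- The vector space `V = ℂ^m`. -/
abbrev V (m : ℕ) : Type := Fin m → ℂ

/-- `det (v_{f 1}, …, v_{f m})`. -/
def minor {m : ℕ} (v : ℤ → V m) (f : Fin m → ℤ) : ℂ := Matrix.det (Matrix.of fun a => v (f a))

/-- Every `m` consecutive vectors are linearly independent. -/
def ConsecGeneric {m : ℕ} (v : ℤ → V m) : Prop :=
  ∀ k : ℤ, LinearIndependent ℂ (fun a : Fin m => v (k + (a : ℤ)))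

/-- The set `(V^N)°` of `N`-tuples `(v_1, …, v_N)` in which every `m` cyclically consecutive
vectors are linearly independent. A tuple is written as the `N`-periodic sequence
`(v_k)_{k ∈ ℤ}` that continues it (so `v_{N+1} = v_1`). Its classes modulo `SL(V)` are the points
of `Gr°(m, N)`, the locus of the affine cone over the Grassmannian where the Plücker coordinates of
all cyclically consecutive `m`-sets are nonzero; the coordinate ring of `Gr°(m, N)` is the
algebra of functions on this set generated by the Plücker coordinates `Δ_I` and the inverses of
the cyclically consecutive ones. -/
structure Config (m N : ℕ) : Type where
  seq : ℤ → V m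
  periodic : ∀ k, seq (k + N) = seq k
  generic : ConsecGeneric seq

lemma minor_altExt {m : ℕ} (v : ℤ → V m) (f : Fin m → ℤ) :
    altExt (fun I : Idx m => minor v I) f = minor v f := by
  unfold altExt
  split_ifs with hf
  · have h : minor v (sortIdx f hf) = (Equiv.Perm.sign (Tuple.sort f) : ℤ) * minor v f := by
      have h1 := Matrix.det_permute (Tuple.sort f) (Matrix.of fun a => v (f a))
      exact_mod_cast h1
    change _ * minor v (sortIdx f hf) = _
    rw [h, ← mul_assoc]
    rcases Int.units_eq_one_or (Equiv.Perm.sign (Tuple.sort f)) with h2 | h2 <;> simp [h2]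
  · simp only [Function.Injective, not_forall] at hf
    obtain ⟨a, b, hab, hne⟩ := hf
    symm
    exact Matrix.det_zero_of_row_eq hne (by funext c; simp [hab])

lemma sum_smul_minor {m : ℕ} (b : Fin (m + 1) → V m) :
    ∑ t : Fin (m + 1), ((-1) ^ (t : ℕ) *
      Matrix.det (Matrix.of fun k : Fin m => b (t.succAbove k))) • b t = 0 := by
  funext c
  have h := Matrix.det_succ_row_zero
    (Matrix.of fun (r s : Fin (m + 1)) => (Fin.cons (b s c) (b s) : Fin (m + 1) → ℂ) r)
  have h0 : Matrix.det
      (Matrix.of fun (r s : Fin (m + 1)) => (Fin.cons (b s c) (b s) : Fin (m + 1) → ℂ) r) = 0 := by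
    refine Matrix.det_zero_of_row_eq (Fin.succ_ne_zero c).symm ?_
    funext s
    simp
  rw [h0] at h
  rw [Finset.sum_apply, Pi.zero_apply, h]
  refine Finset.sum_congr rfl fun t _ => ?_
  rw [Pi.smul_apply, smul_eq_mul]
  have h1 : ((Matrix.of fun (r s : Fin (m + 1)) =>
      (Fin.cons (b s c) (b s) : Fin (m + 1) → ℂ) r).submatrix Fin.succ t.succAbove).det =
      Matrix.det (Matrix.of fun k : Fin m => b (t.succAbove k)) := by
    rw [← Matrix.det_transpose]
    congr 1
  rw [h1]
  simp
  ring

/-- The determinants of vectors in `V` satisfy the Plücker relations. -/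
lemma pluckerExpr_minor {m : ℕ} (hm : 0 < m) (v : ℤ → V m)
    (i : Fin (m - 1) ↪o ℤ) (j : Fin (m + 1) ↪o ℤ) :
    pluckerExpr (fun I : Idx m => minor v I) i j = 0 := by
  classical
  unfold pluckerExpr
  simp only [minor_altExt]
  let l : Fin m := ⟨m - 1, by omega⟩
  let φ : V m →ₗ[ℂ] ℂ :=
    (Matrix.detRowAlternating (n := Fin m) (R := ℂ)).toMultilinearMap.toLinearMap
      (fun a => v (appendLast i 0 a)) l
  have hφ : ∀ s : ℤ, φ (v s) = minor v (appendLast i s) := by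
    intro s
    change Matrix.det _ = Matrix.det _
    congr 1
    funext a
    by_cases ha : a = l
    · subst ha
      rw [Function.update_self]
      change _ = v _
      simp [appendLast, l]
    · have h1 : (a : ℕ) < m - 1 := by
        have h2 : (a : ℕ) ≠ m - 1 := fun h => ha (Fin.ext h)
        omega
      rw [Function.update_of_ne ha]
      change v _ = v _
      simp [appendLast, h1]
  have h := congrArg φ (sum_smul_minor (fun t : Fin (m + 1) => v (j t)))
  rw [map_sum, map_zero] at h
  rw [← neg_eq_zero, ← Finset.sum_neg_distrib, ← h]
  refine Finset.sum_congr rfl fun t _ => ?_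
  rw [map_smul, hφ, smul_eq_mul, pow_succ]
  change _ = (-1) ^ (t : ℕ) * minor v (fun k => j (t.succAbove k)) * _
  ring

lemma minor_ne_zero {m : ℕ} {v : ℤ → V m} (hv : ConsecGeneric v) (k : ℤ) :
    minor v (fun a => k + (a : ℤ)) ≠ 0 := by
  have h : IsUnit (Matrix.of fun a : Fin m => v (k + (a : ℤ))) :=
    Matrix.linearIndependent_rows_iff_isUnit.mp (hv k)
  exact ((Matrix.isUnit_iff_isUnit_det _).mp h).ne_zero

/-- The homomorphism from `Gr_m` to functions on `(V^N)°` that sends `P_I` to the Plücker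
coordinate `Δ_I(v) = det (v_{i₁}, …, v_{i_m})`. On `Gr_m^N` it is the identification of `Gr_m^N`
with the coordinate ring of the locus in the affine cone over the Grassmannian where all `Δ_J`,
`J ⊆ [1, N]` consecutive, are nonzero. -/
def toFun {m : ℕ} (hm : 1 < m) (N : ℕ) : Gr m →ₐ[ℂ] (Config m N → ℂ) :=
  grLift (fun I v => minor v.seq I)
    (by
      rintro I ⟨a, ha⟩
      rw [Pi.isUnit_iff]
      intro v
      have h : (⇑I : Fin m → ℤ) = fun k : Fin m => a + (k : ℤ) := funext ha
      change IsUnit (minor v.seq (⇑I : Fin m → ℤ))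
      rw [h]
      exact (minor_ne_zero v.generic a).isUnit)
    (by
      intro i j
      funext v
      have h := pluckerExpr_map (Pi.evalRingHom (fun _ : Config m N => ℂ) v)
        (fun (I : Idx m) (v : Config m N) => minor v.seq I) i j
      exact h.trans (pluckerExpr_minor (by omega) v.seq i j))

/-! ### Fraser's braid group action -/

/-- The vector
`w_j = det(v_j, v_{j+2}, …, v_{j+m}) / det(v_{j+1}, v_{j+2}, …, v_{j+m}) • v_{j+1} - v_j`. -/
def wVec {m : ℕ} (v : ℤ → V m) (j : ℤ) : V m :=
  (minor v (fun a => if (a : ℕ) = 0 then j else j + 1 + (a : ℤ)) /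
    minor v (fun a => j + 1 + (a : ℤ))) • v (j + 1) - v j

/-- The map `κ_i` on sequences: in every window `[v_{tm+1}, …, v_{tm+m}]` the vectors
`v_{tm+i}, v_{tm+i+1}` are replaced by `v_{tm+i+1}, w_{tm+i}`. -/
def kappaSeq {m : ℕ} (i : ℕ) (v : ℤ → V m) (k : ℤ) : V m :=
  if (m : ℤ) ∣ k - i then v (k + 1)
  else if (m : ℤ) ∣ k - (i + 1) then wVec v (k - 1)
  else v k

lemma wVec_periodic {m N : ℕ} {v : ℤ → V m} (hv : ∀ k, v (k + N) = v k) (j : ℤ) :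
    wVec v (j + N) = wVec v j := by
  have h1 : ∀ f g : Fin m → ℤ, (∀ a, g a = f a + N) → minor v g = minor v f := by
    intro f g h
    unfold minor
    congr 2
    funext a
    rw [h, hv]
  have h2 := h1 (fun a => if (a : ℕ) = 0 then j else j + 1 + (a : ℤ))
    (fun a => if (a : ℕ) = 0 then j + N else j + N + 1 + (a : ℤ)) (fun a => by split_ifs <;> ring)
  have h3 := h1 (fun a => j + 1 + (a : ℤ)) (fun a => j + N + 1 + (a : ℤ)) (fun a => by ring)
  unfold wVec
  rw [h2, h3, hv, show j + N + 1 = (j + 1) + N by ring, hv]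

lemma kappaSeq_periodic {m N : ℕ} (hN : m ∣ N) (i : ℕ) {v : ℤ → V m}
    (hv : ∀ k, v (k + N) = v k) (k : ℤ) : kappaSeq i v (k + N) = kappaSeq i v k := by
  have hN' : (m : ℤ) ∣ (N : ℤ) := Int.natCast_dvd_natCast.mpr hN
  have h1 : (m : ℤ) ∣ k + N - i ↔ (m : ℤ) ∣ k - i := by
    rw [show k + (N : ℤ) - i = (k - i) + N by ring, dvd_add_left hN']
  have h2 : (m : ℤ) ∣ k + N - (i + 1) ↔ (m : ℤ) ∣ k - (i + 1) := by
    rw [show k + (N : ℤ) - (i + 1) = (k - (i + 1)) + N by ring, dvd_add_left hN']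
  unfold kappaSeq
  rw [if_congr h1 rfl rfl, if_congr h2 rfl rfl, hv,
    show k + (N : ℤ) + 1 = (k + 1) + N by ring, hv,
    show k + (N : ℤ) - 1 = (k - 1) + N by ring, wVec_periodic hv]

lemma range_eq_image {m : ℕ} (v : ℤ → V m) (k : ℤ) :
    Set.range (fun a : Fin m => v (k + (a : ℤ))) = v '' Set.Ico k (k + m) := by
  ext x
  constructor
  · rintro ⟨a, rfl⟩
    exact ⟨_, ⟨by omega, by omega⟩, rfl⟩
  · rintro ⟨b, ⟨h1, h2⟩, rfl⟩
    refine ⟨⟨(b - k).toNat, by omega⟩, ?_⟩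
    change v (k + ((b - k).toNat : ℤ)) = v b
    congr 1
    omega

lemma ConsecGeneric.span_eq_top {m : ℕ} {v : ℤ → V m} (hv : ConsecGeneric v) (k : ℤ) :
    Submodule.span ℂ (v '' Set.Ico k (k + m)) = ⊤ := by
  rw [← range_eq_image]
  exact (hv k).span_eq_top_of_card_eq_finrank' (by simp)

lemma consecGeneric_of_span {m : ℕ} {v : ℤ → V m}
    (h : ∀ k : ℤ, Submodule.span ℂ (v '' Set.Ico k (k + m)) = ⊤) : ConsecGeneric v := by
  intro k
  refine linearIndependent_of_top_le_span_of_card_eq_finrank ?_ (by simp)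
  rw [range_eq_image, h]

/-- `w_j` lies in the span of `v_{j+2}, …, v_{j+m}`. -/
lemma wVec_mem_span {m : ℕ} (hm : 1 < m) {v : ℤ → V m} (hv : ConsecGeneric v) (j : ℤ) :
    wVec v j ∈ Submodule.span ℂ (v '' Set.Ico (j + 2) (j + 1 + m)) := by
  classical
  let z : Fin m := ⟨0, by omega⟩
  let φ : V m →ₗ[ℂ] ℂ :=
    (Matrix.detRowAlternating (n := Fin m) (R := ℂ)).toMultilinearMap.toLinearMap
      (fun a => v (j + 1 + (a : ℤ))) z
  have hφ : ∀ s : ℤ,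
      φ (v s) = minor v (fun a => if (a : ℕ) = 0 then s else j + 1 + (a : ℤ)) := by
    intro s
    change Matrix.det _ = Matrix.det _
    congr 1
    funext a
    by_cases ha : a = z
    · subst ha
      rw [Function.update_self]
      change _ = v _
      simp [z]
    · have h1 : (a : ℕ) ≠ 0 := fun h => ha (Fin.ext h)
      rw [Function.update_of_ne ha]
      change v _ = v _
      simp [h1]
  have hD : φ (v (j + 1)) = minor v (fun a => j + 1 + (a : ℤ)) := by
    rw [hφ]
    congr 1
    funext a
    split_ifs with h
    · simp [h]
    · rfl
  have hD0 : φ (v (j + 1)) ≠ 0 := by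
    rw [hD]
    exact minor_ne_zero hv _
  have hw : φ (wVec v j) = 0 := by
    unfold wVec
    rw [map_sub, map_smul, smul_eq_mul, ← hφ, ← hD, div_mul_cancel₀ _ hD0, sub_self]
  have hker : Submodule.span ℂ (v '' Set.Ico (j + 2) (j + 1 + m)) ≤ LinearMap.ker φ := by
    refine Submodule.span_le.mpr ?_
    rintro _ ⟨b, ⟨h1, h2⟩, rfl⟩
    change φ (v b) = 0
    rw [hφ]
    have hne : z ≠ ⟨(b - (j + 1)).toNat, by omega⟩ := by
      intro h
      have h3 := congrArg Fin.val h
      simp only [z] at h3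
      omega
    refine Matrix.det_zero_of_row_eq hne ?_
    change v _ = v _
    congr 1
    have h3 : (b - (j + 1)).toNat ≠ 0 := by omega
    simp only [z, if_true, h3, if_false]
    omega
  have hset : Set.Ico (j + 1) (j + 1 + m) = insert (j + 1) (Set.Ico (j + 2) (j + 1 + m)) := by
    ext x
    simp only [Set.mem_insert_iff, Set.mem_Ico]
    omega
  have hmem : wVec v j ∈ Submodule.span ℂ (v '' Set.Ico (j + 1) (j + 1 + m)) := by
    rw [hv.span_eq_top]
    trivial
  rw [hset, Set.image_insert_eq, Submodule.mem_span_insert] at hmem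
  obtain ⟨α, u, hu, he⟩ := hmem
  have hu0 : φ u = 0 := hker hu
  rw [he, map_add, map_smul, hu0, add_zero, smul_eq_mul] at hw
  have hα : α = 0 := (mul_eq_zero.mp hw).resolve_right hD0
  rw [he, hα, zero_smul, zero_add]
  exact hu

/-- The map `κ_i` preserves consecutive genericity. -/
lemma kappaSeq_generic {m : ℕ} (hm : 1 < m) (i : ℕ) {v : ℤ → V m} (hv : ConsecGeneric v) :
    ConsecGeneric (kappaSeq i v) := by
  have hA : ∀ k : ℤ, (m : ℤ) ∣ k - i → kappaSeq i v k = v (k + 1) := fun k h => if_pos h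
  have hn : ∀ k : ℤ, (m : ℤ) ∣ k - (i + 1) → ¬ (m : ℤ) ∣ k - i := by
    intro k h h'
    have h1 := Int.le_of_dvd (by norm_num) ((dvd_sub h' h).trans (dvd_of_eq (by ring : _ = (1 : ℤ))))
    omega
  have hB : ∀ k : ℤ, (m : ℤ) ∣ k - (i + 1) → kappaSeq i v k = wVec v (k - 1) := fun k h => by
    unfold kappaSeq
    rw [if_neg (hn k h), if_pos h]
  have hC : ∀ k : ℤ, ¬ (m : ℤ) ∣ k - i → ¬ (m : ℤ) ∣ k - (i + 1) → kappaSeq i v k = v k :=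
    fun k h h' => by
      unfold kappaSeq
      rw [if_neg h, if_neg h']
  refine consecGeneric_of_span fun k => ?_
  rw [eq_top_iff]
  set T := Submodule.span ℂ (kappaSeq i v '' Set.Ico k (k + m)) with hT
  have hmemT : ∀ b : ℤ, k ≤ b → b < k + m → kappaSeq i v b ∈ T := fun b h1 h2 =>
    Submodule.subset_span ⟨b, ⟨h1, h2⟩, rfl⟩
  by_cases hk : (m : ℤ) ∣ k - (i + 1)
  · -- the block starts with the second vector of a replaced pair
    have hgap : ∀ b : ℤ, k < b → b < k + m → ¬ (m : ℤ) ∣ b - (i + 1) := by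
      intro b h1 h2 h
      have h3 := Int.le_of_dvd (by omega)
        ((dvd_sub h hk).trans (dvd_of_eq (by ring : _ = b - k)))
      omega
    have hlast : (m : ℤ) ∣ (k + m - 1) - i := by
      have h1 := dvd_add hk (dvd_refl (m : ℤ))
      exact h1.trans (dvd_of_eq (by ring))
    have hgap' : ∀ b : ℤ, k ≤ b → b < k + m - 1 → ¬ (m : ℤ) ∣ b - i := by
      intro b h1 h2 h
      have h3 := Int.le_of_dvd (by omega)
        ((dvd_sub hlast h).trans (dvd_of_eq (by ring : _ = k + m - 1 - b)))
      omega
    have hmid : ∀ b : ℤ, k < b → b < k + m - 1 → v b ∈ T := by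
      intro b h1 h2
      rw [← hC b (hgap' b h1.le h2) (hgap b h1 (by omega))]
      exact hmemT b h1.le (by omega)
    have htop : v (k + m) ∈ T := by
      have h1 := hA _ hlast
      rw [show k + (m : ℤ) - 1 + 1 = k + m by ring] at h1
      rw [← h1]
      exact hmemT _ (by omega) (by omega)
    have hw : wVec v (k - 1) ∈ T := by
      rw [← hB k hk]
      exact hmemT k le_rfl (by omega)
    have hpen : v (k + m - 1) ∈ T := by
      have h1 := wVec_mem_span hm hv (k - 1)
      have hset : Set.Ico (k - 1 + 2) (k - 1 + 1 + (m : ℤ)) =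
          insert (k + m - 1) (Set.Ico (k + 1) (k + m - 1)) := by
        ext x
        simp only [Set.mem_insert_iff, Set.mem_Ico]
        omega
      rw [hset, Set.image_insert_eq, Submodule.mem_span_insert] at h1
      obtain ⟨e, u, hu, he⟩ := h1
      have huT : u ∈ T := by
        refine (Submodule.span_le.mpr ?_ :
          Submodule.span ℂ (v '' Set.Ico (k + 1) (k + m - 1)) ≤ T) hu
        rintro _ ⟨b, ⟨h2, h3⟩, rfl⟩
        exact hmid b (by omega) h3
      have he0 : e ≠ 0 := by
        rintro rfl
        rw [zero_smul, zero_add] at he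
        have hli := hv (k - 1)
        have hns := hli.notMem_span_image (s := {⟨0, by omega⟩}ᶜ) (x := ⟨0, by omega⟩)
          (by simp)
        apply hns
        have hsub : ∀ b : ℤ, k ≤ b → b < k + m - 1 → v b ∈ Submodule.span ℂ
            ((fun a : Fin m => v (k - 1 + (a : ℤ))) '' {⟨0, by omega⟩}ᶜ) := by
          intro b h2 h3
          refine Submodule.subset_span ⟨⟨(b - (k - 1)).toNat, by omega⟩, ?_, ?_⟩
          · intro h
            have h4 := congrArg Fin.val h
            simp only at h4
            omega
          · change v _ = v b
            congr 1
            simp only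
            omega
        have hu' := (Submodule.span_le.mpr (by
          rintro _ ⟨b, ⟨h2, h3⟩, rfl⟩
          exact hsub b (by omega) h3) :
          Submodule.span ℂ (v '' Set.Ico (k + 1) (k + m - 1)) ≤ _) hu
        rw [← he] at hu'
        unfold wVec at hu'
        rw [show k - 1 + 1 = k by ring] at hu'
        have h6 := (Submodule.sub_mem_iff_right _
          (Submodule.smul_mem _ _ (hsub k le_rfl (by omega)))).mp hu'
        simpa using h6
      have h2 : v (k + m - 1) = e⁻¹ • (wVec v (k - 1) - u) := by
        rw [he, add_sub_cancel_right, smul_smul, inv_mul_cancel₀ he0, one_smul]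
      rw [h2]
      exact T.smul_mem _ (T.sub_mem hw huT)
    rw [← hv.span_eq_top (k + 1), Submodule.span_le]
    rintro _ ⟨b, ⟨h1, h2⟩, rfl⟩
    rcases lt_trichotomy b (k + m - 1) with h | h | h
    · exact hmid b (by omega) h
    · rw [h]
      exact hpen
    · rw [show b = k + m by omega]
      exact htop
  · -- the block contains both or none of the vectors of each replaced pair
    rw [← hv.span_eq_top k, Submodule.span_le]
    rintro _ ⟨b, ⟨h1, h2⟩, rfl⟩
    change v b ∈ T
    by_cases hb : (m : ℤ) ∣ b - i
    · have hb1 : b + 1 < k + m := by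
        by_contra hcon
        apply hk
        have h3 : k - (i + 1 : ℤ) = (b - i) - m := by omega
        rw [h3]
        exact dvd_sub hb (dvd_refl _)
      have h3 : (m : ℤ) ∣ (b + 1) - (i + 1) := by
        rw [show b + 1 - ((i : ℤ) + 1) = b - i by ring]
        exact hb
      have h4 := hmemT (b + 1) (by omega) hb1
      rw [hB _ h3, show b + 1 - 1 = b by ring] at h4
      have h5 := hmemT b h1 h2
      rw [hA b hb] at h5
      unfold wVec at h4
      exact (Submodule.sub_mem_iff_right _ (T.smul_mem _ h5)).mp h4
    · by_cases hb' : (m : ℤ) ∣ b - (i + 1)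
      · have hbk : b ≠ k := by
          rintro rfl
          exact hk hb'
        have h3 : (m : ℤ) ∣ (b - 1) - i := by
          rw [show b - 1 - (i : ℤ) = b - (i + 1) by ring]
          exact hb'
        have h4 := hmemT (b - 1) (by omega) (by omega)
        rw [hA _ h3, sub_add_cancel] at h4
        exact h4
      · rw [← hC b hb hb']
        exact hmemT b h1 h2

/-- The map `κ_i` on `(V^N)°`, for `m ∣ N`. -/
def kappa {m N : ℕ} (hm : 1 < m) (hN : m ∣ N) (i : ℕ) (v : Config m N) : Config m N where
  seq := kappaSeq i v.seq
  periodic := kappaSeq_periodic hN i v.periodic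
  generic := kappaSeq_generic hm i v.generic

/-- Fraser's action of the `i`-th braid generator for `(m, N)`, `m ∣ N`: the pullback of functions
along `κ_i`. -/
def fraser {m N : ℕ} (hm : 1 < m) (hN : m ∣ N) (i : ℕ) :
    (Config m N → ℂ) →ₐ[ℂ] (Config m N → ℂ) :=
  AlgHom.ofLinearMap (LinearMap.funLeft ℂ ℂ (kappa hm hN i)) rfl (fun _ _ => rfl)

end

end InfGrass

/-! The action exists already on `Gr m`, before the consecutive coordinates are set to 1, and it
comes from one operation on sequences of vectors over an arbitrary commutative ring.

Over a ring in which the consecutive minors Δ_k = det(v_k, …, v_{k+m-1}) are units, κ_i makes sense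
for sequences v : ℤ → A^m. By multilinearity the minors of κ_i v are polynomials in the minors of v
and in the inverses of the Δ_k (`seqMinor_kappaOver`), so they depend only on the minors of v and
are compatible with ring homomorphisms. Moreover `Gr m` carries a universal sequence: the Plücker
relations together with the invertibility of P_{1,…,m} force the P_I to be the minors of explicit
vectors (`seqMinor_pluckerVec`). Hence P_I ↦ (minor I of κ_i of the universal sequence) is an
endomorphism of `Gr m`; the minors again satisfy the Plücker relations, and its consecutive values
are units because κ_i keeps Δ_k or replaces it by Δ_{k-1} Δ_{k+1} / Δ_k. The same formulas show that
it descends to `GrBar m`. Composites of endomorphisms correspond to composites of the κ_i in reverse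
order, so every identity between the κ_i passes to the algebras.

The braid relations for the κ_i rest on uniqueness: x is the exchange coefficient at j as soon as x
v_{j+1} - v_j lies in the span of v_{j+2}, …, v_{j+m} (`exchCoeff_eq_of_mem`). All coefficients
after several exchanges are then found by comparing spans, without computing determinants.

For the comparison with Fraser's action, evaluation at a periodic configuration intertwines the
endomorphism with pullback along κ_i, again by naturality. An exchange uses only vectors at bounded
distance, so level n goes into level N once N ≥ n + m. On level N ≥ m evaluation at configurations
is injective (`eq_zero_of_toFun_eq_zero`), so the function determines the element. The extension to
`GrBar m` is the descended endomorphism itself, which commutes with the shift by m. -/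

namespace InfGrass

noncomputable section

/-! ### Minors of sequences of vectors over a commutative ring -/

section Sequences

variable {m : ℕ} {A : Type*} [CommRing A]

/-- `det (v_{f 1}, …, v_{f m})` over a commutative ring. -/
def seqMinor (v : ℤ → Fin m → A) (f : Fin m → ℤ) : A := Matrix.det (Matrix.of fun a => v (f a))

/-- `det (v_k, …, v_{k+m-1})`. -/
def consecMinor (v : ℤ → Fin m → A) (k : ℤ) : A := seqMinor v fun a => k + (a : ℤ)

/-- All determinants of `m` consecutive vectors are invertible. -/
def UnitConsec (v : ℤ → Fin m → A) : Prop := ∀ k, IsUnit (consecMinor v k)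

/-- `u ↦ det (v_{f 1}, …, u, …, v_{f m})` with `u` in place `b`. -/
def rowMap (v : ℤ → Fin m → A) (f : Fin m → ℤ) (b : Fin m) : (Fin m → A) →ₗ[A] A :=
  (Matrix.detRowAlternating (n := Fin m) (R := A)).toMultilinearMap.toLinearMap
    (fun a => v (f a)) b

lemma rowMap_apply (v : ℤ → Fin m → A) (f : Fin m → ℤ) (b : Fin m) (u : Fin m → A) :
    rowMap v f b u = Matrix.det ((Matrix.of fun a => v (f a)).updateRow b u) := rfl

lemma rowMap_seq (v : ℤ → Fin m → A) (f : Fin m → ℤ) (b : Fin m) (k : ℤ) :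
    rowMap v f b (v k) = seqMinor v (Function.update f b k) := by
  rw [rowMap_apply]
  unfold seqMinor
  congr 1
  ext a c
  by_cases h : a = b
  · subst h
    simp
  · simp [h]

/-- `u ↦ det (v_k, …, u, …, v_{k+m-1})` with `u` in place `b`. -/
def winMap (v : ℤ → Fin m → A) (k : ℤ) (b : Fin m) : (Fin m → A) →ₗ[A] A :=
  rowMap v (fun a => k + (a : ℤ)) b

lemma winMap_self (v : ℤ → Fin m → A) (k : ℤ) (b : Fin m) :
    winMap v k b (v (k + (b : ℤ))) = consecMinor v k := by
  rw [winMap, rowMap_seq, consecMinor]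
  congr 1
  exact Function.update_eq_self b _

lemma winMap_of_ne (v : ℤ → Fin m → A) (k : ℤ) (b : Fin m) {l : ℤ} (h1 : k ≤ l) (h2 : l < k + m)
    (h : l ≠ k + b) : winMap v k b (v l) = 0 := by
  obtain ⟨c, rfl⟩ : ∃ c : Fin m, l = k + (c : ℤ) := ⟨⟨(l - k).toNat, by omega⟩, by simp; omega⟩
  have hcb : c ≠ b := fun e => h (by rw [e])
  rw [winMap, rowMap_seq]
  refine Matrix.det_zero_of_row_eq hcb ?_
  funext x
  simp [hcb]

/-- Cramer's rule for a window of consecutive vectors. -/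
lemma consecMinor_smul (v : ℤ → Fin m → A) (k : ℤ) (u : Fin m → A) :
    consecMinor v k • u = ∑ b : Fin m, winMap v k b u • v (k + (b : ℤ)) := by
  have h := Matrix.mulVec_cramer (Matrix.of fun a : Fin m => v (k + (a : ℤ))).transpose u
  rw [Matrix.det_transpose] at h
  refine Eq.trans (b := Matrix.det (Matrix.of fun a : Fin m => v (k + (a : ℤ))) • u) rfl ?_
  rw [← h]
  funext c
  simp only [Matrix.mulVec, dotProduct, Matrix.cramer_transpose_apply, Finset.sum_apply,
    Pi.smul_apply, smul_eq_mul, Matrix.transpose_apply, Matrix.of_apply]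
  exact Finset.sum_congr rfl fun b _ => mul_comm _ _


lemma seqMinor_perm (v : ℤ → Fin m → A) (f : Fin m → ℤ) (π : Equiv.Perm (Fin m)) :
    seqMinor v (fun a => f (π a)) = ((Equiv.Perm.sign π : ℤ) : A) * seqMinor v f :=
  Matrix.det_permute π (Matrix.of fun a => v (f a))

/-! ### The exchange of two neighbouring vectors -/

/-- The coefficient of `v_{j+1}` in the vector that replaces `v_j`. -/
def exchCoeff (v : ℤ → Fin m → A) (j : ℤ) : A :=
  -- `Ring.inverse` is 0 at non-units, so the coefficient is total; it has its intended meaning only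
  -- where the consecutive minor is a unit.
  Ring.inverse (consecMinor v (j + 1)) *
    seqMinor v (fun a => if (a : ℕ) = 0 then j else j + 1 + (a : ℤ))

/-- The vector `x • v_{j+1} - v_j` in the span of `v_{j+2}, …, v_{j+m}`. -/
def exchVec (v : ℤ → Fin m → A) (j : ℤ) : Fin m → A := exchCoeff v j • v (j + 1) - v j

/-- The map `κ_i` for sequences over a commutative ring. -/
def kappaOver (i : ℕ) (v : ℤ → Fin m → A) (k : ℤ) : Fin m → A :=
  if (m : ℤ) ∣ k - i then v (k + 1)
  else if (m : ℤ) ∣ k - (i + 1) then exchVec v (k - 1)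
  else v k

/-! ### Uniqueness of the exchange coefficient -/

lemma exchCoeff_eq [NeZero m] (v : ℤ → Fin m → A) (j : ℤ) :
    exchCoeff v j = Ring.inverse (consecMinor v (j + 1)) * winMap v (j + 1) 0 (v j) := by
  rw [exchCoeff, winMap, rowMap_seq]
  congr 2
  funext a
  by_cases h : a = 0
  · subst h
    simp
  · have h' : (a : ℕ) ≠ 0 := fun e => h (Fin.ext (by simpa using e))
    simp [h, h']

/-- By Cramer's rule `winMap v k 0` is, up to the unit Δ_k, the coordinate along v_k in the window
basis. -/
lemma mem_span_of_winMap [NeZero m] {v : ℤ → Fin m → A} {k : ℤ} (hk : IsUnit (consecMinor v k))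
    {u : Fin m → A} (hu : winMap v k 0 u = 0) :
    u ∈ Submodule.span A (v '' Set.Ico (k + 1) (k + m)) := by
  rw [← Submodule.smul_mem_iff_of_isUnit _ hk, consecMinor_smul]
  refine Submodule.sum_mem _ fun b _ => ?_
  by_cases h : b = 0
  · rw [h, hu, zero_smul]
    exact zero_mem _
  · have h' : (b : ℕ) ≠ 0 := fun e => h (Fin.ext (by simpa using e))
    exact Submodule.smul_mem _ _ (Submodule.subset_span ⟨_, ⟨by omega, by omega⟩, rfl⟩)

lemma winMap_zero_eq_zero [NeZero m] {v : ℤ → Fin m → A} {k : ℤ} {u : Fin m → A}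
    (hu : u ∈ Submodule.span A (v '' Set.Ico (k + 1) (k + m))) : winMap v k 0 u = 0 := by
  suffices h : Submodule.span A (v '' Set.Ico (k + 1) (k + m)) ≤ LinearMap.ker (winMap v k 0) from
    h hu
  refine Submodule.span_le.mpr ?_
  rintro _ ⟨l, ⟨h1, h2⟩, rfl⟩
  exact winMap_of_ne v k 0 (by omega) (by omega) (by simp; omega)

lemma winMap_zero_self [NeZero m] (v : ℤ → Fin m → A) (k : ℤ) :
    winMap v k 0 (v k) = consecMinor v k := by
  simpa using winMap_self v k 0

lemma winMap_exchVec [NeZero m] {v : ℤ → Fin m → A} {j : ℤ}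
    (hj : IsUnit (consecMinor v (j + 1))) : winMap v (j + 1) 0 (exchVec v j) = 0 := by
  rw [exchVec, map_sub, map_smul, winMap_zero_self, exchCoeff_eq, smul_eq_mul, mul_right_comm,
    Ring.inverse_mul_cancel _ hj, one_mul, sub_self]

lemma exchVec_mem_span [NeZero m] {v : ℤ → Fin m → A} {j : ℤ}
    (hj : IsUnit (consecMinor v (j + 1))) :
    exchVec v j ∈ Submodule.span A (v '' Set.Ico (j + 2) (j + 1 + m)) := by
  have h := mem_span_of_winMap hj (winMap_exchVec hj)
  rwa [show j + 1 + 1 = j + 2 by ring] at h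

/-- Applying `winMap v (j + 1) 0`, which kills the span on the right, leaves an equation for x with
unit coefficient. This is the tool by which exchange coefficients are determined in the proofs of
the braid relations. -/
lemma exchCoeff_eq_of_mem [NeZero m] {v : ℤ → Fin m → A} {j : ℤ}
    (hj : IsUnit (consecMinor v (j + 1))) {x : A}
    (hx : x • v (j + 1) - v j ∈ Submodule.span A (v '' Set.Ico (j + 2) (j + 1 + m))) :
    exchCoeff v j = x := by
  rw [show j + 2 = j + 1 + 1 by ring] at hx
  have h := winMap_zero_eq_zero hx
  rw [map_sub, map_smul, winMap_zero_self, sub_eq_zero, smul_eq_mul] at h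
  rw [exchCoeff_eq, ← h, mul_comm x, ← mul_assoc, Ring.inverse_mul_cancel _ hj, one_mul]

lemma exchVec_eq_of_mem [NeZero m] {v : ℤ → Fin m → A} {j : ℤ}
    (hj : IsUnit (consecMinor v (j + 1))) {x : A}
    (hx : x • v (j + 1) - v j ∈ Submodule.span A (v '' Set.Ico (j + 2) (j + 1 + m))) :
    exchVec v j = x • v (j + 1) - v j := by
  rw [exchVec, exchCoeff_eq_of_mem hj hx]

lemma kappaOver_of_dvd {i : ℕ} (v : ℤ → Fin m → A) {k : ℤ} (hk : (m : ℤ) ∣ k - i) :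
    kappaOver i v k = v (k + 1) := if_pos hk

lemma not_dvd_of_abs_lt {d : ℤ} (h0 : d ≠ 0) (h1 : -(m : ℤ) < d) (h2 : d < m) : ¬ (m : ℤ) ∣ d :=
  fun h => h0 (Int.eq_zero_of_abs_lt_dvd h (abs_lt.mpr ⟨h1, h2⟩))

lemma not_dvd_add {p d : ℤ} (hp : (m : ℤ) ∣ p) (h0 : d ≠ 0) (h1 : -(m : ℤ) < d) (h2 : d < m) :
    ¬ (m : ℤ) ∣ p + d :=
  fun h => not_dvd_of_abs_lt h0 h1 h2 ((dvd_add_right hp).mp h)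

lemma kappaOver_succ_of_dvd (hm : 1 < m) {i : ℕ} (v : ℤ → Fin m → A) {k : ℤ}
    (hk : (m : ℤ) ∣ k - i) : kappaOver i v (k + 1) = exchVec v k := by
  unfold kappaOver
  rw [if_neg, if_pos, add_sub_cancel_right]
  · rwa [add_sub_add_right_eq_sub]
  · rw [show k + 1 - (i : ℤ) = k - i + 1 by ring]
    exact not_dvd_add hk one_ne_zero (by omega) (by omega)

lemma kappaOver_add_of_dvd {i : ℕ} (v : ℤ → Fin m → A) {p r : ℤ} (hp : (m : ℤ) ∣ p - i)
    (h0 : r ≠ 0) (h1 : r ≠ 1) (h2 : 1 < m + r) (h3 : r < m) :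
    kappaOver i v (p + r) = v (p + r) := by
  unfold kappaOver
  rw [if_neg, if_neg]
  · rw [show p + r - ((i : ℤ) + 1) = p - i + (r - 1) by ring]
    exact not_dvd_add hp (by omega) (by omega) (by omega)
  · rw [show p + r - (i : ℤ) = p - i + r by ring]
    exact not_dvd_add hp (by omega) (by omega) (by omega)

/-- A residue class modulo `m` meets every window of length `m`. -/
lemma exists_dvd_window (hm : 0 < m) (i : ℕ) (k : ℤ) :
    ∃ p : ℤ, k ≤ p ∧ p < k + m ∧ (m : ℤ) ∣ p - i := by
  have h0 : (m : ℤ) ≠ 0 := by omega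
  refine ⟨k + (i - k) % m, ?_, ?_, ?_⟩
  · have := Int.emod_nonneg (i - k) h0
    omega
  · have := Int.emod_lt_of_pos (i - k) (show (0 : ℤ) < m by omega)
    omega
  · have := Int.dvd_self_sub_emod (x := (i - k : ℤ)) (m := m)
    rw [← dvd_neg, show -(k + (i - k) % m - (i : ℤ)) = i - k - (i - k) % m by ring]
    exact this

/-! ### Consecutive minors after an exchange -/

lemma finRotate_val (a : Fin m) :
    ((finRotate m a : Fin m) : ℕ) = if (a : ℕ) + 1 = m then 0 else (a : ℕ) + 1 := by
  obtain ⟨n, rfl⟩ : ∃ n, m = n + 1 := ⟨m - 1, by have := a.2; omega⟩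
  split_ifs with h
  · have : a = Fin.last n := Fin.ext (Nat.succ.inj h)
    rw [this, finRotate_last]
    rfl
  · exact coe_finRotate_of_ne_last fun e => h (by rw [e]; simp)

lemma sign_sq (A : Type*) [CommRing A] (π : Equiv.Perm (Fin m)) :
    ((Equiv.Perm.sign π : ℤ) : A) * ((Equiv.Perm.sign π : ℤ) : A) = 1 := by
  rcases Int.units_eq_one_or (Equiv.Perm.sign π) with h | h <;> simp [h]

/-- The window of κ_i v that starts at k + 1 cuts two pairs: it is w, v_{k+2}, …, v_{k+m-1},
v_{k+m+1} with w the exchange vector at k. Since w lies in the span of v_{k+2}, …, v_{k+m}, only its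
component along v_{k+m} contributes. Cramer's rule gives that component in terms of Δ_k, and the
remaining determinant is Δ_{k+2} up to sign; the two signs are equal and cancel. -/
lemma consecMinor_kappaOver_succ (hm : 1 < m) {i : ℕ} {v : ℤ → Fin m → A} {k : ℤ}
    (hk : (m : ℤ) ∣ k - i) (hu : IsUnit (consecMinor v (k + 1))) :
    consecMinor v (k + 1) * consecMinor (kappaOver i v) (k + 1) =
      consecMinor v k * consecMinor v (k + 2) := by
  have : NeZero m := ⟨by omega⟩
  let z : Fin m := 0
  let l : Fin m := ⟨m - 1, by omega⟩
  have hzl : z ≠ l := fun h => by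
    have := congrArg Fin.val h
    simp [z, l] at this
    omega
  have hz : ∀ a : Fin m, a ≠ z → (a : ℕ) ≠ 0 := fun a h e => h (Fin.ext (by simpa [z] using e))
  have hl : ∀ a : Fin m, a ≠ l → (a : ℕ) + 1 ≠ m := fun a h e => h (Fin.ext (by simp [l]; omega))
  have hlv : ((l : ℕ) : ℤ) = m - 1 := by simp [l]; omega
  have hzv : ((z : ℕ) : ℤ) = 0 := by simp [z]
  -- The indices of this window; place `z` is reserved for the exchange vector.
  let f : Fin m → ℤ := Function.update (fun a => k + 1 + (a : ℤ)) l (k + 1 + m)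
  have hκ : consecMinor (kappaOver i v) (k + 1) = rowMap v f z (exchVec v k) := by
    rw [rowMap_apply]
    unfold consecMinor seqMinor
    congr 1
    funext a
    by_cases haz : a = z
    · rw [haz, Matrix.updateRow_self]
      change kappaOver i v (k + 1 + ((z : ℕ) : ℤ)) = _
      rw [hzv, add_zero, kappaOver_succ_of_dvd hm v hk]
    · rw [Matrix.updateRow_ne haz]
      change kappaOver i v _ = v (f a)
      by_cases hal : a = l
      · have hk' : (m : ℤ) ∣ (k + 1 + ((l : ℕ) : ℤ)) - i := by
          rw [hlv, show k + 1 + ((m : ℤ) - 1) - i = k - i + m by ring]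
          exact dvd_add hk dvd_rfl
        rw [hal, kappaOver_of_dvd v hk']
        simp only [f, Function.update_self]
        congr 1
        omega
      · have := hz a haz
        have := hl a hal
        simp only [f, Function.update_of_ne hal]
        rw [add_assoc, kappaOver_add_of_dvd v hk (by omega) (by omega) (by omega) (by omega)]
  have hL : ∀ b : Fin m, b ≠ z → b ≠ l → rowMap v f z (v (k + 1 + (b : ℤ))) = 0 := by
    intro b hbz hbl
    rw [rowMap_seq]
    refine Matrix.det_zero_of_row_eq hbz ?_
    funext x
    simp [hbz, hbl, f]
  have hexp := congrArg (rowMap v f z) (consecMinor_smul v (k + 1) (exchVec v k))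
  rw [map_smul, map_sum, Finset.sum_eq_single l] at hexp
  rotate_left
  · intro b _ hb
    by_cases hbz : b = z
    · rw [hbz, winMap_exchVec hu, zero_smul, map_zero]
    · rw [map_smul, hL b hbz hb, smul_zero]
  · simp
  have h1 : winMap v (k + 1) l (exchVec v k) =
      -(((Equiv.Perm.sign (finRotate m) : ℤ) : A) * consecMinor v k) := by
    rw [exchVec, map_sub, map_smul,
      winMap_of_ne v (k + 1) l (le_refl _) (by omega) (by omega), smul_zero, zero_sub,
      winMap, rowMap_seq, consecMinor, ← seqMinor_perm]
    congr 2
    funext a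
    rw [finRotate_val]
    by_cases ha : a = l
    · rw [ha, Function.update_self, if_pos (by simp [l]; omega)]
      simp
    · rw [Function.update_of_ne ha, if_neg (hl a ha)]
      push_cast
      ring
  have h2 : rowMap v f z (v (k + 1 + (l : ℤ))) =
      -(((Equiv.Perm.sign (finRotate m) : ℤ) : A) * consecMinor v (k + 2)) := by
    -- Rotating, and then swapping the first and last places, puts v_{k+m}, v_{k+2}, …, v_{k+m-1},
    -- v_{k+m+1} in consecutive order.
    have hg := seqMinor_perm v (Function.update f z (k + 1 + (l : ℤ))) (finRotate m |>.trans (Equiv.swap z l))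
    have hfun : (fun a => Function.update f z (k + 1 + (l : ℤ))
        ((finRotate m |>.trans (Equiv.swap z l)) a)) = fun a : Fin m => k + 2 + (a : ℤ) := by
      funext a
      have hv := finRotate_val a
      rw [Equiv.trans_apply]
      by_cases ha : (a : ℕ) + 1 = m
      · have : finRotate m a = z := Fin.ext (by rw [hv, if_pos ha]; simp [z])
        rw [this, Equiv.swap_apply_left, Function.update_of_ne hzl.symm]
        simp only [f, Function.update_self]
        omega
      · rw [if_neg ha] at hv
        by_cases ha' : finRotate m a = l
        · rw [ha', Equiv.swap_apply_right, Function.update_self]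
          rw [ha'] at hv
          omega
        · have haz : finRotate m a ≠ z := fun e => by
            rw [e] at hv
            simp [z] at hv
          rw [Equiv.swap_apply_of_ne_of_ne haz ha', Function.update_of_ne haz]
          simp only [f, Function.update_of_ne ha', hv]
          push_cast
          ring
    rw [rowMap_seq]
    have hs : ((Equiv.Perm.sign (finRotate m |>.trans (Equiv.swap z l)) : ℤ) : A) =
        -((Equiv.Perm.sign (finRotate m) : ℤ) : A) := by
      rw [Equiv.Perm.sign_trans, Equiv.Perm.sign_swap hzl]
      push_cast
      ring
    rw [hfun, hs] at hg
    change consecMinor v (k + 2) = _ at hg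
    rw [hg]
    linear_combination (-seqMinor v (Function.update f z (k + 1 + (l : ℤ)))) *
      sign_sq A (finRotate m)
  rw [map_smul, h1, h2, ← hκ, smul_eq_mul, smul_eq_mul] at hexp
  rw [hexp]
  linear_combination consecMinor v k * consecMinor v (k + 2) * sign_sq A (finRotate m)

/-- The window contains a whole pair, replaced by v_{p+1}, x v_{p+1} - v_p. This is a substitution
of determinant 1: the multiple of v_{p+1} drops out, and the minus sign compensates the swap. -/
lemma consecMinor_kappaOver_of_dvd (hm : 1 < m) {i : ℕ} {v : ℤ → Fin m → A} {k p : ℤ}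
    (hp : (m : ℤ) ∣ p - i) (h1 : k ≤ p) (h2 : p + 1 < k + m) :
    consecMinor (kappaOver i v) k = consecMinor v k := by
  obtain ⟨r, rfl⟩ : ∃ r : ℕ, p = k + r := ⟨(p - k).toNat, by omega⟩
  let b : Fin m := ⟨r, by omega⟩
  let c : Fin m := ⟨r + 1, by omega⟩
  have hbc : b ≠ c := fun h => by simpa [b, c] using congrArg Fin.val h
  have h3 : winMap v k b (exchVec v (k + r)) = -consecMinor v k := by
    have e := winMap_self v k b
    change winMap v k b (v (k + r)) = _ at e
    rw [exchVec, map_sub, map_smul, e, winMap_of_ne v k b (by omega) (by omega)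
      (by simp [b]), smul_zero, zero_sub]
  have h4 := seqMinor_perm (kappaOver i v) (fun a => k + (a : ℤ)) (Equiv.swap b c)
  rw [Equiv.Perm.sign_swap hbc] at h4
  have h5 : seqMinor (kappaOver i v) (fun a => k + ((Equiv.swap b c a : Fin m) : ℤ)) =
      winMap v k b (exchVec v (k + r)) := by
    rw [winMap, rowMap_apply]
    unfold seqMinor
    congr 1
    funext a
    by_cases hab : a = b
    · subst hab
      rw [Matrix.updateRow_self, ← kappaOver_succ_of_dvd hm v hp]
      change kappaOver i v (k + ((Equiv.swap b c b : Fin m) : ℤ)) = _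
      rw [Equiv.swap_apply_left]
      congr 1
      simp [c]
      ring
    · rw [Matrix.updateRow_ne hab]
      change kappaOver i v (k + ((Equiv.swap b c a : Fin m) : ℤ)) = v (k + (a : ℤ))
      by_cases hac : a = c
      · subst hac
        rw [Equiv.swap_apply_right]
        change kappaOver i v (k + r) = v (k + ((r + 1 : ℕ) : ℤ))
        rw [kappaOver_of_dvd v hp]
        congr 1
        push_cast
        ring
      · rw [Equiv.swap_apply_of_ne_of_ne hab hac]
        have e1 : (a : ℕ) ≠ r := fun e => hab (Fin.ext e)
        have e2 : (a : ℕ) ≠ r + 1 := fun e => hac (Fin.ext e)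
        rw [show k + ((a : ℕ) : ℤ) = k + r + (a - r) by ring]
        exact kappaOver_add_of_dvd v hp (by omega) (by omega) (by omega) (by omega)
  rw [h5, h3] at h4
  simpa [consecMinor] using h4.symm

lemma UnitConsec.kappaOver (hm : 1 < m) (i : ℕ) {v : ℤ → Fin m → A} (hv : UnitConsec v) :
    UnitConsec (kappaOver i v) := by
  intro k
  obtain ⟨p, h1, h2, hp⟩ := exists_dvd_window (m := m) (by omega) i k
  by_cases h3 : p + 1 < k + m
  · rw [consecMinor_kappaOver_of_dvd hm hp h1 h3]
    exact hv k
  -- Here p = k + m - 1, so the window begins with the second vector of the preceding pair.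
  · have hp' : (m : ℤ) ∣ (k - 1) - i := by
      rw [show k - 1 - (i : ℤ) = p - i - m by omega]
      exact dvd_sub hp dvd_rfl
    have h := consecMinor_kappaOver_succ hm hp' (hv _)
    rw [sub_add_cancel] at h
    exact isUnit_of_mul_isUnit_right (h ▸ (hv _).mul (hv _))

end Sequences

/-! ### Braid relations for the exchange maps -/

section Braid

variable {m : ℕ} {A : Type*} [CommRing A]

lemma span_image_Ico_insert (v : ℤ → Fin m → A) {a b : ℤ} (h : a < b) {u : Fin m → A}
    (hu : u ∈ Submodule.span A (v '' Set.Ico a b)) :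
    ∃ α : A, u - α • v a ∈ Submodule.span A (v '' Set.Ico (a + 1) b) := by
  have hset : Set.Ico a b = insert a (Set.Ico (a + 1) b) := by
    ext x
    simp only [Set.mem_insert_iff, Set.mem_Ico]
    omega
  rw [hset, Set.image_insert_eq, Submodule.mem_span_insert] at hu
  obtain ⟨α, z, hz, rfl⟩ := hu
  exact ⟨α, by rwa [add_sub_cancel_left]⟩

lemma span_image_Ico_last (v : ℤ → Fin m → A) {a b : ℤ} (h : a ≤ b) {u : Fin m → A}
    (hu : u ∈ Submodule.span A (v '' Set.Ico a (b + 1))) :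
    ∃ α : A, u - α • v b ∈ Submodule.span A (v '' Set.Ico a b) := by
  have hset : Set.Ico a (b + 1) = insert b (Set.Ico a b) := by
    ext x
    simp only [Set.mem_insert_iff, Set.mem_Ico]
    omega
  rw [hset, Set.image_insert_eq, Submodule.mem_span_insert] at hu
  obtain ⟨α, z, hz, rfl⟩ := hu
  exact ⟨α, by rwa [add_sub_cancel_left]⟩

lemma span_image_Ico_le {v : ℤ → Fin m → A} {a b : ℤ} {T : Submodule A (Fin m → A)}
    (h : ∀ l, a ≤ l → l < b → v l ∈ T) : Submodule.span A (v '' Set.Ico a b) ≤ T := by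
  refine Submodule.span_le.mpr ?_
  rintro _ ⟨l, ⟨h1, h2⟩, rfl⟩
  exact h l h1 h2

lemma mem_span_Ico (v : ℤ → Fin m → A) {a b l : ℤ} (h1 : a ≤ l) (h2 : l < b) :
    v l ∈ Submodule.span A (v '' Set.Ico a b) := Submodule.subset_span ⟨l, ⟨h1, h2⟩, rfl⟩

/-- Modulo m, j is neither i nor a neighbour of i, so each j-pair meeting the places p + 2, …, p + m
lies wholly among them. Within a pair κ_j does not change the span, so by uniqueness it leaves the
exchange at p unchanged. -/
lemma exchCoeff_kappaOver (hm : 1 < m) {i j : ℕ} (h1 : ¬ (m : ℤ) ∣ i - j)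
    (h2 : ¬ (m : ℤ) ∣ i - (j + 1)) (h3 : ¬ (m : ℤ) ∣ j - (i + 1)) {v : ℤ → Fin m → A}
    (hv : UnitConsec v) {p : ℤ} (hp : (m : ℤ) ∣ p - i) :
    kappaOver j v p = v p ∧ kappaOver j v (p + 1) = v (p + 1) ∧
      exchVec (kappaOver j v) p = exchVec v p := by
  have : NeZero m := ⟨by omega⟩
  have hshift : ∀ {d e : ℤ}, (m : ℤ) ∣ d → ¬ (m : ℤ) ∣ e → ¬ (m : ℤ) ∣ d + e :=
    fun hd he h => he ((dvd_add_right hd).mp h)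
  have h1' : ¬ (m : ℤ) ∣ (j : ℤ) - i := fun h => h1 (by rw [← dvd_neg]; simpa using h)
  have hp0 : kappaOver j v p = v p := by
    unfold kappaOver
    rw [if_neg, if_neg]
    · rw [show p - ((j : ℤ) + 1) = p - i + (i - (j + 1)) by ring]
      exact hshift hp h2
    · rw [show p - (j : ℤ) = p - i + (i - j) by ring]
      exact hshift hp h1
  have hp1 : kappaOver j v (p + 1) = v (p + 1) := by
    unfold kappaOver
    rw [if_neg, if_neg]
    · rw [show p + 1 - ((j : ℤ) + 1) = p - i + (i - j) by ring]
      exact hshift hp h1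
    · rw [show p + 1 - (j : ℤ) = -(-(p - i) + (j - (i + 1))) by ring, dvd_neg]
      exact hshift (by rwa [dvd_neg]) h3
  refine ⟨hp0, hp1, ?_⟩
  rw [exchVec_eq_of_mem (x := exchCoeff v p) (hv.kappaOver hm j (p + 1)), hp0, hp1]
  · rfl
  rw [hp0, hp1]
  refine span_image_Ico_le (fun l hl1 hl2 => ?_) (exchVec_mem_span (hv (p + 1)))
  by_cases hl : (m : ℤ) ∣ l - j
  · have hlast : l + 1 < p + 1 + m := by
      by_contra hcon
      apply h1'
      rw [show (j : ℤ) - i = p - i + m - (l - j) by omega]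
      exact dvd_sub (dvd_add hp dvd_rfl) hl
    have e1 := mem_span_Ico (kappaOver j v) (a := p + 2) (b := p + 1 + m) hl1 hl2
    have e2 := mem_span_Ico (kappaOver j v) (a := p + 2) (b := p + 1 + m) (l := l + 1)
      (by omega) hlast
    rw [kappaOver_of_dvd v hl] at e1
    rw [kappaOver_succ_of_dvd hm v hl, exchVec] at e2
    exact (Submodule.sub_mem_iff_right _ (Submodule.smul_mem _ _ e1)).mp e2
  · by_cases hl' : (m : ℤ) ∣ l - 1 - j
    · have hfirst : p + 2 ≤ l - 1 := by
        by_contra hcon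
        apply h3
        rw [show (j : ℤ) - (i + 1) = p - i - (l - 1 - j) by omega]
        exact dvd_sub hp hl'
      have e1 := mem_span_Ico (kappaOver j v) (a := p + 2) (b := p + 1 + m) hfirst (by omega)
      rwa [kappaOver_of_dvd v hl', sub_add_cancel] at e1
    · have e1 := mem_span_Ico (kappaOver j v) (a := p + 2) (b := p + 1 + m) hl1 hl2
      have e : kappaOver j v l = v l := by
        unfold kappaOver
        rw [if_neg hl, if_neg]
        rwa [show l - ((j : ℤ) + 1) = l - 1 - j by ring]
      rwa [e] at e1

/-- Exchanges at distant places commute. -/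
lemma kappaOver_comm (hm : 1 < m) {i j : ℕ} (h1 : ¬ (m : ℤ) ∣ i - j)
    (h2 : ¬ (m : ℤ) ∣ i - (j + 1)) (h3 : ¬ (m : ℤ) ∣ j - (i + 1)) {v : ℤ → Fin m → A}
    (hv : UnitConsec v) : kappaOver i (kappaOver j v) = kappaOver j (kappaOver i v) := by
  have h1' : ¬ (m : ℤ) ∣ (j : ℤ) - i := fun h => h1 (by rw [← dvd_neg]; simpa using h)
  -- Only the places of the i-pairs are treated; those of the j-pairs follow by interchanging i and
  -- j, and all other places are fixed by both maps.
  have key : ∀ {i j : ℕ}, ¬ (m : ℤ) ∣ i - j → ¬ (m : ℤ) ∣ i - (j + 1) → ¬ (m : ℤ) ∣ j - (i + 1) →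
      ∀ p : ℤ, (m : ℤ) ∣ p - i →
        kappaOver i (kappaOver j v) p = kappaOver j (kappaOver i v) p ∧
        kappaOver i (kappaOver j v) (p + 1) = kappaOver j (kappaOver i v) (p + 1) := by
    intro i j h1 h2 h3 p hp
    have hshift : ∀ {d e : ℤ}, (m : ℤ) ∣ d → ¬ (m : ℤ) ∣ e → ¬ (m : ℤ) ∣ d + e :=
      fun hd he h => he ((dvd_add_right hd).mp h)
    have hoff0 : ∀ u : ℤ → Fin m → A, kappaOver j u p = u p := fun u => by
      unfold kappaOver
      rw [if_neg, if_neg]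
      · rw [show p - ((j : ℤ) + 1) = p - i + (i - (j + 1)) by ring]
        exact hshift hp h2
      · rw [show p - (j : ℤ) = p - i + (i - j) by ring]
        exact hshift hp h1
    have hoff1 : ∀ u : ℤ → Fin m → A, kappaOver j u (p + 1) = u (p + 1) := fun u => by
      unfold kappaOver
      rw [if_neg, if_neg]
      · rw [show p + 1 - ((j : ℤ) + 1) = p - i + (i - j) by ring]
        exact hshift hp h1
      · rw [show p + 1 - (j : ℤ) = -(-(p - i) + (j - (i + 1))) by ring, dvd_neg]
        exact hshift (by rwa [dvd_neg]) h3
    obtain ⟨-, e2, e3⟩ := exchCoeff_kappaOver hm h1 h2 h3 hv hp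
    rw [hoff0, hoff1, kappaOver_of_dvd _ hp, kappaOver_of_dvd _ hp, kappaOver_succ_of_dvd hm _ hp,
      kappaOver_succ_of_dvd hm _ hp]
    exact ⟨e2, e3⟩
  funext k
  by_cases hi : (m : ℤ) ∣ k - i
  · exact (key h1 h2 h3 k hi).1
  by_cases hi' : (m : ℤ) ∣ k - 1 - i
  · simpa using (key h1 h2 h3 (k - 1) hi').2
  by_cases hj : (m : ℤ) ∣ k - j
  · exact (key h1' h3 h2 k hj).1.symm
  by_cases hj' : (m : ℤ) ∣ k - 1 - j
  · simpa using (key h1' h3 h2 (k - 1) hj').2.symm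
  have hi'' : ¬ (m : ℤ) ∣ k - (i + 1) := by rwa [show k - ((i : ℤ) + 1) = k - 1 - i by ring]
  have hj'' : ¬ (m : ℤ) ∣ k - (j + 1) := by rwa [show k - ((j : ℤ) + 1) = k - 1 - j by ring]
  simp only [kappaOver, if_neg hi, if_neg hi'', if_neg hj, if_neg hj'']

/-- In the window `(a, b, c, …, d)` starting from `p`, with `d = v_{p+m}`: reducing `a` modulo
`b` and `c` gives a vector of the span of the following ones, in which `d` occurs with invertible
coefficient. -/
lemma exists_third_vector (hm : 2 < m) {v : ℤ → Fin m → A} (hv : UnitConsec v) (p : ℤ) :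
    ∃ α : A, v p - exchCoeff v p • v (p + 1) - α • v (p + 2) ∈
        Submodule.span A (v '' Set.Ico (p + 3) (p + m + 1)) ∧
      v (p + m) ∈ Submodule.span A (insert (v p - exchCoeff v p • v (p + 1) - α • v (p + 2))
        (v '' Set.Ico (p + 3) (p + m))) := by
  have : NeZero m := ⟨by omega⟩
  obtain ⟨α, hα⟩ := span_image_Ico_insert v (by omega) (exchVec_mem_span (hv (p + 1)))
  have hW : v p - exchCoeff v p • v (p + 1) - (-α) • v (p + 2) ∈
      Submodule.span A (v '' Set.Ico (p + 3) (p + m + 1)) := by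
    rw [← Submodule.neg_mem_iff]
    rw [exchVec, show p + 2 + 1 = p + 3 by ring, show p + 1 + (m : ℤ) = p + m + 1 by ring] at hα
    convert hα using 1
    module
  refine ⟨-α, hW, ?_⟩
  set W := v p - exchCoeff v p • v (p + 1) - (-α) • v (p + 2) with hWdef
  obtain ⟨ε, hε⟩ := span_image_Ico_last v (by omega) hW
  -- the coefficient of the last vector is invertible
  have hker : ∀ l, p + 1 ≤ l → l < p + m → winMap v p 0 (v l) = 0 := fun l h1 h2 =>
    winMap_of_ne v p 0 (by omega) h2 (by simp; omega)
  have hle : Submodule.span A (v '' Set.Ico (p + 3) (p + m)) ≤ LinearMap.ker (winMap v p 0) :=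
    span_image_Ico_le fun l h1 h2 => hker l (by omega) h2
  have h0 : winMap v p 0 (W - ε • v (p + m)) = 0 := hle hε
  rw [map_sub, hWdef, map_sub, map_sub, map_smul, map_smul, hker _ le_rfl (by omega),
    hker (p + 2) (by omega) (by omega), winMap_zero_self, smul_zero, smul_zero, sub_zero,
    sub_zero, map_smul, smul_eq_mul, sub_eq_zero] at h0
  -- The functional kills v_{p+1}, …, v_{p+m-1} and sends W to Δ_p, so ε divides a unit.
  have hεu : IsUnit ε := isUnit_of_mul_isUnit_left (h0 ▸ hv p)
  rw [← Submodule.smul_mem_iff_of_isUnit _ hεu, ← sub_sub_self W (ε • v (p + m))]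
  exact Submodule.sub_mem _ (Submodule.subset_span (Set.mem_insert _ _))
    (Submodule.span_mono (Set.subset_insert _ _) hε)

/-- The braid relation for neighbouring exchanges. -/
lemma kappaOver_braid {i : ℕ} (hm : 2 < m) {v : ℤ → Fin m → A} (hv : UnitConsec v) :
    kappaOver i (kappaOver (i + 1) (kappaOver i v)) =
      kappaOver (i + 1) (kappaOver i (kappaOver (i + 1) v)) := by
  have : NeZero m := ⟨by omega⟩
  have hm1 : 1 < m := by omega
  -- Write a, b, c for the vectors at p, p + 1, p + 2, x and y for the exchange coefficients of v at
  -- p and p + 1, and W = a - x b - α c. One side runs (a, b, c) → (b, x b - a, c) → (b, c, W) → (c,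
  -- y c - b, W), the other (a, b, c) → (a, c, y c - b) → (c, (x y + α) c - a, y c - b) → (c, y c -
  -- b, W). It remains to verify the coefficients in these steps, each by a span argument.
  choose α hW hlast using exists_third_vector hm hv
  set W : ℤ → Fin m → A := fun p => v p - exchCoeff v p • v (p + 1) - α p • v (p + 2) with hWd
  -- values of the two exchange maps in a window
  have A0 : ∀ {u w : ℤ → Fin m → A}, w = kappaOver i u →
      ∀ {p : ℤ}, (m : ℤ) ∣ p - i → w p = u (p + 1) :=
    fun {u w} hw {p} hp => hw ▸ kappaOver_of_dvd u hp
  have A1 : ∀ {u w : ℤ → Fin m → A}, w = kappaOver i u →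
      ∀ {p : ℤ}, (m : ℤ) ∣ p - i → w (p + 1) = exchCoeff u p • u (p + 1) - u p :=
    fun {u w} hw {p} hp => hw ▸ kappaOver_succ_of_dvd hm1 u hp
  have A2 : ∀ {u w : ℤ → Fin m → A}, w = kappaOver i u →
      ∀ {p l : ℤ}, (m : ℤ) ∣ p - i → p + 2 ≤ l → l < p + m → w l = u l := fun {u w} hw {p l} hp h1 h2 => by
    subst hw
    rw [show l = p + (l - p) by ring]
    exact kappaOver_add_of_dvd u hp (by omega) (by omega) (by omega) (by omega)
  have hsucc : ∀ {p : ℤ}, (m : ℤ) ∣ p - i → (m : ℤ) ∣ (p + 1) - ((i + 1 : ℕ) : ℤ) := by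
    intro p hp
    push_cast
    rwa [add_sub_add_right_eq_sub]
  have B0 : ∀ {u w : ℤ → Fin m → A}, w = kappaOver (i + 1) u →
      ∀ {p : ℤ}, (m : ℤ) ∣ p - i → w p = u p := by
    intro u w hw p hp
    subst hw
    have := kappaOver_add_of_dvd u (hsucc hp) (r := -1) (by omega) (by omega) (by omega) (by omega)
    simpa using this
  have B1 : ∀ {u w : ℤ → Fin m → A}, w = kappaOver (i + 1) u →
      ∀ {p : ℤ}, (m : ℤ) ∣ p - i → w (p + 1) = u (p + 2) := fun {u w} hw {p} hp => by
    subst hw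
    rw [kappaOver_of_dvd u (hsucc hp)]
    congr 1
    ring
  have B2 : ∀ {u w : ℤ → Fin m → A}, w = kappaOver (i + 1) u →
      ∀ {p : ℤ}, (m : ℤ) ∣ p - i → w (p + 2) = exchCoeff u (p + 1) • u (p + 2) - u (p + 1) := fun {u w} hw {p} hp => by
    subst hw
    have := kappaOver_succ_of_dvd hm1 u (hsucc hp)
    rwa [exchVec, show p + 1 + 1 = p + 2 by ring] at this
  have B3 : ∀ {u w : ℤ → Fin m → A}, w = kappaOver (i + 1) u →
      ∀ {p l : ℤ}, (m : ℤ) ∣ p - i → p + 3 ≤ l → l < p + m → w l = u l := fun {u w} hw {p l} hp h1 h2 => by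
    subst hw
    rw [show l = p + 1 + (l - p - 1) by ring]
    exact kappaOver_add_of_dvd u (hsucc hp) (by omega) (by omega) (by omega) (by omega)
  have hnext : ∀ {p : ℤ}, (m : ℤ) ∣ p - i → (m : ℤ) ∣ p + m - i := fun {p} hp => by
    rw [show p + (m : ℤ) - i = p - i + m by ring]
    exact dvd_add hp dvd_rfl
  have hY : ∀ p, exchCoeff v (p + 1) • v (p + 2) - v (p + 1) ∈
      Submodule.span A (v '' Set.Ico (p + 3) (p + m + 2)) := fun p => by
    have := exchVec_mem_span (hv (p + 1 + 1))
    rwa [exchVec, show p + 1 + 2 = p + 3 by ring,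
      show p + 1 + 1 + (m : ℤ) = p + m + 2 by ring, show p + 1 + 1 = p + 2 by ring] at this
  set v1 := kappaOver i v with hv1'
  set v2 := kappaOver (i + 1) v1 with hv2'
  set u1 := kappaOver (i + 1) v with hu1'
  set u2 := kappaOver i u1 with hu2'
  have hv1 : UnitConsec v1 := hv.kappaOver hm1 i
  have hv2 : UnitConsec v2 := hv1.kappaOver hm1 _
  have hu1 : UnitConsec u1 := hv.kappaOver hm1 _
  have hu2 : UnitConsec u2 := hu1.kappaOver hm1 _
  have C1 : ∀ {p : ℤ}, (m : ℤ) ∣ p - i → exchCoeff v1 (p + 1) = -α p := by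
    intro p hp
    refine exchCoeff_eq_of_mem (hv1 _) ?_
    rw [show p + 1 + 1 = p + 2 by ring, A1 hv1' hp, A2 hv1' hp le_rfl (by omega)]
    rw [show -α p • v (p + 2) - (exchCoeff v p • v (p + 1) - v p) = W p by simp only [hWd]; module]
    refine span_image_Ico_le (fun l h1 h2 => ?_) (hW p)
    have e0 := mem_span_Ico v1 (a := p + 1 + 2) (b := p + 2 + m) (l := p + m) (by omega) (by omega)
    have e1 := mem_span_Ico v1 (a := p + 1 + 2) (b := p + 2 + m) (l := p + m + 1)
      (by omega) (by omega)
    rw [A0 hv1' (hnext hp)] at e0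
    rw [A1 hv1' (hnext hp)] at e1
    rcases lt_or_eq_of_le (show l ≤ p + m by omega) with h | h
    · rw [← A2 hv1' hp (by omega) h]
      exact mem_span_Ico v1 (by omega) (by omega)
    · rw [h]
      -- The next pair has become v_{p+m+1}, x' v_{p+m+1} - v_{p+m}, from which v_{p+m} is
      -- recovered.
      exact (Submodule.sub_mem_iff_right _ (Submodule.smul_mem _ _ e0)).mp e1
  have V0 : ∀ {p : ℤ}, (m : ℤ) ∣ p - i → v2 p = v (p + 1) := fun hp => by
    rw [B0 hv2' hp, A0 hv1' hp]
  have V1 : ∀ {p : ℤ}, (m : ℤ) ∣ p - i → v2 (p + 1) = v (p + 2) := fun hp => by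
    rw [B1 hv2' hp, A2 hv1' hp le_rfl (by omega)]
  have V2 : ∀ {p : ℤ}, (m : ℤ) ∣ p - i → v2 (p + 2) = W p := fun {p} hp => by
    rw [B2 hv2' hp, C1 hp, A1 hv1' hp, A2 hv1' hp le_rfl (by omega)]
    simp only [hWd]
    module
  have V3 : ∀ {p l : ℤ}, (m : ℤ) ∣ p - i → p + 3 ≤ l → l < p + m → v2 l = v l :=
    fun hp h1 h2 => by rw [B3 hv2' hp h1 h2, A2 hv1' hp (by omega) h2]
  have C2 : ∀ {p : ℤ}, (m : ℤ) ∣ p - i → exchCoeff v2 p = exchCoeff v (p + 1) := by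
    intro p hp
    refine exchCoeff_eq_of_mem (hv2 _) ?_
    rw [V0 hp, V1 hp]
    refine span_image_Ico_le (fun l h1 h2 => ?_) (hY p)
    have hR : ∀ l, p + 3 ≤ l → l < p + m →
        v l ∈ Submodule.span A (v2 '' Set.Ico (p + 2) (p + 1 + m)) := fun l h1 h2 => by
      rw [← V3 hp h1 h2]
      exact mem_span_Ico v2 (by omega) (by omega)
    rcases lt_trichotomy l (p + m) with h | h | h
    · exact hR l h1 h
    · rw [h]
      -- The vector v_{p+m} no longer occurs in the window of `v2`; it is recovered from W, where
      -- its coefficient is a unit.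
      refine Submodule.span_le.mpr (Set.insert_subset ?_ ?_) (hlast p)
      · change W p ∈ _
        rw [← V2 hp]
        exact mem_span_Ico v2 le_rfl (by omega)
      · rintro _ ⟨l, ⟨h1, h2⟩, rfl⟩
        exact hR l h1 h2
    · rw [show l = p + m + 1 by omega, ← V0 (hnext hp)]
      exact mem_span_Ico v2 (by omega) (by omega)
  have D1 : ∀ {p : ℤ}, (m : ℤ) ∣ p - i →
      exchCoeff u1 p = exchCoeff v p * exchCoeff v (p + 1) + α p := by
    intro p hp
    refine exchCoeff_eq_of_mem (hu1 _) ?_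
    rw [B0 hu1' hp, B1 hu1' hp]
    have hYm := mem_span_Ico u1 (a := p + 2) (b := p + 1 + m) le_rfl (by omega)
    rw [B2 hu1' hp] at hYm
    have hWm : W p ∈ Submodule.span A (u1 '' Set.Ico (p + 2) (p + 1 + m)) := by
      refine span_image_Ico_le (fun l h1 h2 => ?_) (hW p)
      have e : u1 l = v l := by
        rcases lt_or_eq_of_le (show l ≤ p + m by omega) with h | h
        · exact B3 hu1' hp h1 h
        · rw [h]
          exact B0 hu1' (hnext hp)
      rw [← e]
      exact mem_span_Ico u1 (by omega) (by omega)
    -- (x y + α) c - a = x (y c - b) - W.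
    have := Submodule.sub_mem _ (Submodule.smul_mem _ (exchCoeff v p) hYm) hWm
    convert this using 1
    simp only [hWd]
    module
  have U0 : ∀ {p : ℤ}, (m : ℤ) ∣ p - i → u2 p = v (p + 2) := fun hp => by
    rw [A0 hu2' hp, B1 hu1' hp]
  have U1 : ∀ {p : ℤ}, (m : ℤ) ∣ p - i → u2 (p + 1) =
      (exchCoeff v p * exchCoeff v (p + 1) + α p) • v (p + 2) - v p := fun hp => by
    rw [A1 hu2' hp, B1 hu1' hp, B0 hu1' hp, D1 hp]
  have U2 : ∀ {p : ℤ}, (m : ℤ) ∣ p - i →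
      u2 (p + 2) = exchCoeff v (p + 1) • v (p + 2) - v (p + 1) := fun hp => by
    rw [A2 hu2' hp le_rfl (by omega), B2 hu1' hp]
  have U3 : ∀ {p l : ℤ}, (m : ℤ) ∣ p - i → p + 3 ≤ l → l < p + m → u2 l = v l :=
    fun hp h1 h2 => by rw [A2 hu2' hp (by omega) h2, B3 hu1' hp h1 h2]
  have D2 : ∀ {p : ℤ}, (m : ℤ) ∣ p - i → exchCoeff u2 (p + 1) = exchCoeff v p := by
    intro p hp
    refine exchCoeff_eq_of_mem (hu2 _) ?_
    rw [show p + 1 + 1 = p + 2 by ring, U1 hp, U2 hp]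
    rw [show exchCoeff v p • (exchCoeff v (p + 1) • v (p + 2) - v (p + 1)) -
      ((exchCoeff v p * exchCoeff v (p + 1) + α p) • v (p + 2) - v p) = W p by
        simp only [hWd]; module]
    refine span_image_Ico_le (fun l h1 h2 => ?_) (hW p)
    rcases lt_or_eq_of_le (show l ≤ p + m by omega) with h | h
    · rw [← U3 hp h1 h]
      exact mem_span_Ico u2 (by omega) (by omega)
    · have e0 := mem_span_Ico u2 (a := p + 1 + 2) (b := p + 2 + m) (l := p + m)
        (by omega) (by omega)
      have e1 := mem_span_Ico u2 (a := p + 1 + 2) (b := p + 2 + m) (l := p + m + 1)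
        (by omega) (by omega)
      rw [U0 (hnext hp)] at e0
      rw [U1 (hnext hp)] at e1
      rw [h]
      exact (Submodule.sub_mem_iff_right _ (Submodule.smul_mem _ _ e0)).mp e1
  funext k
  -- The last place of residue i not beyond k, so that 0 ≤ k - p < m.
  obtain ⟨p, hp1, hp2, hp⟩ := exists_dvd_window (m := m) (by omega) i (k - m + 1)
  rcases (show k = p ∨ k = p + 1 ∨ k = p + 2 ∨ p + 3 ≤ k by omega) with h | h | h | h
  · rw [h, A0 (u := v2) rfl hp, B0 (u := u2) rfl hp, V1 hp, U0 hp]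
  · rw [h, A1 (u := v2) rfl hp, B1 (u := u2) rfl hp, V0 hp, V1 hp, U2 hp, C2 hp]
  · rw [h, A2 (u := v2) rfl hp le_rfl (by omega), B2 (u := u2) rfl hp, V2 hp, U1 hp, U2 hp, D2 hp]
    simp only [hWd]
    module
  · rw [A2 (u := v2) rfl hp (by omega) (by omega), B3 (u := u2) rfl hp h (by omega), V3 hp h (by omega),
      U3 hp h (by omega)]

end Braid

/-! ### Minors of exchanged sequences -/

section Expansion

variable {m : ℕ} {A B : Type*} [CommRing A] [CommRing B]

/-- The coefficients in the expression of an exchanged sequence by the original one. -/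
def kappaCoeff (i : ℕ) (v : ℤ → Fin m → A) (k : ℤ) (s : Fin 2) : A :=
  -- Only the second vector of a pair is a genuine sum of two terms; elsewhere the second term is
  -- padding with coefficient 0.
  if (m : ℤ) ∣ k - i then ![1, 0] s
  else if (m : ℤ) ∣ k - (i + 1) then ![exchCoeff v (k - 1), -1] s
  else ![1, 0] s

/-- The indices in the expression of an exchanged sequence by the original one. -/
def kappaIdx (m i : ℕ) (k : ℤ) (s : Fin 2) : ℤ :=
  if (m : ℤ) ∣ k - i then k + 1
  else if (m : ℤ) ∣ k - (i + 1) then ![k, k - 1] s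
  else k

lemma kappaOver_eq_sum (i : ℕ) (v : ℤ → Fin m → A) (k : ℤ) :
    kappaOver i v k = ∑ s : Fin 2, kappaCoeff i v k s • v (kappaIdx m i k s) := by
  unfold kappaOver kappaCoeff kappaIdx
  split_ifs <;> simp [exchVec, sub_eq_add_neg]

/-- Multilinear expansion. It shows that minors of the exchanged sequence depend only on minors of
the original one, and which indices enter them. -/
lemma seqMinor_kappaOver (i : ℕ) (v : ℤ → Fin m → A) (f : Fin m → ℤ) :
    seqMinor (kappaOver i v) f = ∑ r : Fin m → Fin 2,
      (∏ a, kappaCoeff i v (f a) (r a)) * seqMinor v (fun a => kappaIdx m i (f a) (r a)) := by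
  have h : seqMinor (kappaOver i v) f =
      (Matrix.detRowAlternating (n := Fin m) (R := A)).toMultilinearMap
        (fun a => ∑ s : Fin 2, kappaCoeff i v (f a) s • v (kappaIdx m i (f a) s)) := by
    simp only [← kappaOver_eq_sum]
    rfl
  rw [h, MultilinearMap.map_sum]
  refine Finset.sum_congr rfl fun r _ => ?_
  rw [MultilinearMap.map_smul_univ]
  rfl

lemma kappaCoeff_congr {u v : ℤ → Fin m → A} (h : ∀ f, seqMinor u f = seqMinor v f) (i : ℕ)
    (k : ℤ) (s : Fin 2) : kappaCoeff i u k s = kappaCoeff i v k s := by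
  simp only [kappaCoeff, exchCoeff, consecMinor, h]

/-- The minors of an exchanged sequence depend only on the minors of the original one. -/
lemma seqMinor_kappaOver_congr {u v : ℤ → Fin m → A} (h : ∀ f, seqMinor u f = seqMinor v f)
    (i : ℕ) (f : Fin m → ℤ) : seqMinor (kappaOver i u) f = seqMinor (kappaOver i v) f := by
  simp only [seqMinor_kappaOver, h, kappaCoeff_congr h]

/-! ### Naturality under ring homomorphisms and shifts -/

/-- The image of a sequence of vectors under a ring homomorphism. -/
def mapSeq (φ : A →+* B) (v : ℤ → Fin m → A) : ℤ → Fin m → B := fun k a => φ (v k a)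

lemma seqMinor_mapSeq (φ : A →+* B) (v : ℤ → Fin m → A) (f : Fin m → ℤ) :
    seqMinor (mapSeq φ v) f = φ (seqMinor v f) := by
  unfold seqMinor
  rw [RingHom.map_det]
  rfl

/-- Away from units this can fail, which is why naturality of κ_i needs invertible consecutive
minors. -/
lemma map_ring_inverse (φ : A →+* B) {x : A} (hx : IsUnit x) :
    φ (Ring.inverse x) = Ring.inverse (φ x) := by
  have h1 : φ (Ring.inverse x) * φ x = 1 := by
    rw [← map_mul, Ring.inverse_mul_cancel x hx, map_one]
  exact (Ring.eq_mul_inverse_iff_mul_eq _ 1 _ (hx.map φ)).mpr h1 |>.trans (one_mul _)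

lemma exchCoeff_mapSeq (φ : A →+* B) {v : ℤ → Fin m → A} (hv : UnitConsec v) (j : ℤ) :
    exchCoeff (mapSeq φ v) j = φ (exchCoeff v j) := by
  rw [exchCoeff, exchCoeff, map_mul, map_ring_inverse φ (hv (j + 1)), consecMinor, consecMinor,
    seqMinor_mapSeq, seqMinor_mapSeq]

lemma kappaOver_mapSeq (φ : A →+* B) {v : ℤ → Fin m → A} (hv : UnitConsec v) (i : ℕ) :
    kappaOver i (mapSeq φ v) = mapSeq φ (kappaOver i v) := by
  have h : ∀ j, exchVec (mapSeq φ v) j = fun a => φ (exchVec v j a) := fun j => by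
    funext a
    simp [exchVec, exchCoeff_mapSeq φ hv, mapSeq]
  funext k a
  simp only [kappaOver, h, mapSeq]
  split_ifs <;> rfl

lemma exchVec_shift (v : ℤ → Fin m → A) (t j : ℤ) :
    exchVec (fun k => v (k + t)) j = exchVec v (j + t) := by
  have h : ∀ f g : Fin m → ℤ, (∀ a, g a = f a + t) →
      seqMinor (fun k => v (k + t)) f = seqMinor v g := by
    intro f g h
    unfold seqMinor
    congr 2
    funext a
    rw [h]
  have h1 := h (fun a => if (a : ℕ) = 0 then j else j + 1 + (a : ℤ))
    (fun a => if (a : ℕ) = 0 then j + t else j + t + 1 + (a : ℤ)) (fun a => by split_ifs <;> ring)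
  have h2 := h (fun a => j + 1 + (a : ℤ)) (fun a => j + t + 1 + (a : ℤ)) (fun a => by ring)
  simp only [exchVec, exchCoeff, consecMinor, h1, h2]
  rw [show j + 1 + t = j + t + 1 by ring]

lemma kappaOver_shift (i : ℕ) (v : ℤ → Fin m → A) (k : ℤ) :
    kappaOver i (fun k => v (k + m)) k = kappaOver i v (k + m) := by
  have h1 : (m : ℤ) ∣ k + m - i ↔ (m : ℤ) ∣ k - i := by
    rw [show k + (m : ℤ) - i = (k - i) + m by ring, dvd_add_left dvd_rfl]
  have h2 : (m : ℤ) ∣ k + m - (i + 1) ↔ (m : ℤ) ∣ k - (i + 1) := by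
    rw [show k + (m : ℤ) - (i + 1) = (k - (i + 1)) + m by ring, dvd_add_left dvd_rfl]
  unfold kappaOver
  rw [if_congr h1 rfl rfl, if_congr h2 rfl rfl, exchVec_shift,
    show k + (m : ℤ) + 1 = (k + 1) + m by ring, show k + (m : ℤ) - 1 = (k - 1) + m by ring]

end Expansion

/-! ### Plücker relations over a commutative ring -/

section Pluecker

variable {m : ℕ} {A : Type*} [CommRing A]

lemma altExt_of_not_injective (x : Idx m → A) {f : Fin m → ℤ} (hf : ¬ Function.Injective f) :
    altExt x f = 0 := dif_neg hf

lemma altExt_perm (x : Idx m → A) (f : Fin m → ℤ) (π : Equiv.Perm (Fin m)) :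
    altExt x (fun a => f (π a)) = ((Equiv.Perm.sign π : ℤ) : A) * altExt x f := by
  by_cases hf : Function.Injective f
  · have hf' : Function.Injective (fun a => f (π a)) := hf.comp π.injective
    have h1 : (f ∘ π) ∘ Tuple.sort (f ∘ π) = f ∘ Tuple.sort f :=
      Tuple.comp_perm_comp_sort_eq_comp_sort
    have h2 : Tuple.sort f = (Tuple.sort (f ∘ π)).trans π := by
      ext a
      have := hf (congrFun h1 a)
      exact congrArg Fin.val this.symm
    have h3 : sortIdx (fun a => f (π a)) hf' = sortIdx f hf := by
      ext a
      exact congrFun h1 a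
    unfold altExt
    rw [dif_pos hf, dif_pos hf', h3, h2, Equiv.Perm.sign_trans]
    change ((Equiv.Perm.sign (Tuple.sort (f ∘ π)) : ℤ) : A) * _ = _
    push_cast
    rw [← mul_assoc, ← mul_assoc, sign_sq, one_mul]
  · have hf' : ¬ Function.Injective (fun a => f (π a)) := fun h => hf fun a b hab => by
      have := @h (π.symm a) (π.symm b) (by simpa using hab)
      simpa using this
    rw [altExt_of_not_injective x hf, altExt_of_not_injective x hf', mul_zero]

lemma altExt_coe (x : Idx m → A) (I : Idx m) : altExt x I = x I := by
  have h : Tuple.sort (I : Fin m → ℤ) = Equiv.refl _ :=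
    (Tuple.eq_sort_iff.mpr ⟨(by simpa using I.monotone), fun i j hij h => absurd (I.injective h) hij.ne⟩ :
      Equiv.refl _ = Tuple.sort (I : Fin m → ℤ)).symm
  unfold altExt
  rw [dif_pos I.injective]
  have h2 : sortIdx (I : Fin m → ℤ) I.injective = I := by
    ext a
    change I (Tuple.sort (I : Fin m → ℤ) a) = I a
    rw [h]
    rfl
  rw [h2, h]
  simp

lemma altExt_seqMinor (v : ℤ → Fin m → A) (f : Fin m → ℤ) :
    altExt (fun I : Idx m => seqMinor v I) f = seqMinor v f := by
  by_cases hf : Function.Injective f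
  · unfold altExt
    rw [dif_pos hf]
    have h := seqMinor_perm v f (Tuple.sort f)
    change _ * seqMinor v (fun a => f (Tuple.sort f a)) = _
    rw [h, ← mul_assoc, sign_sq, one_mul]
  · rw [altExt_of_not_injective _ hf]
    simp only [Function.Injective, not_forall] at hf
    obtain ⟨a, b, hab, hne⟩ := hf
    symm
    exact Matrix.det_zero_of_row_eq hne (by funext c; simp [hab])

/-- In coordinate c this is the expansion, along the first row, of the (m+1) × (m+1) determinant
with columns (b_s(c), b_s), which has a repeated row. -/
lemma sum_smul_det {m : ℕ} (b : Fin (m + 1) → Fin m → A) :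
    ∑ t : Fin (m + 1), ((-1) ^ (t : ℕ) *
      Matrix.det (Matrix.of fun k : Fin m => b (t.succAbove k))) • b t = 0 := by
  funext c
  have h := Matrix.det_succ_row_zero
    (Matrix.of fun (r s : Fin (m + 1)) => (Fin.cons (b s c) (b s) : Fin (m + 1) → A) r)
  have h0 : Matrix.det
      (Matrix.of fun (r s : Fin (m + 1)) => (Fin.cons (b s c) (b s) : Fin (m + 1) → A) r) = 0 := by
    refine Matrix.det_zero_of_row_eq (Fin.succ_ne_zero c).symm ?_
    funext s
    simp
  rw [h0] at h
  rw [Finset.sum_apply, Pi.zero_apply, h]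
  refine Finset.sum_congr rfl fun t _ => ?_
  rw [Pi.smul_apply, smul_eq_mul]
  have h1 : ((Matrix.of fun (r s : Fin (m + 1)) =>
      (Fin.cons (b s c) (b s) : Fin (m + 1) → A) r).submatrix Fin.succ t.succAbove).det =
      Matrix.det (Matrix.of fun k : Fin m => b (t.succAbove k)) := by
    rw [← Matrix.det_transpose]
    congr 1
  rw [h1]
  simp
  ring

lemma update_appendLast (hm : 0 < m) (i : Fin (m - 1) → ℤ) (j j' : ℤ) :
    Function.update (appendLast i j) ⟨m - 1, by omega⟩ j' = appendLast i j' := by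
  funext a
  by_cases ha : a = ⟨m - 1, by omega⟩
  · subst ha
    simp [appendLast]
  · have h1 : (a : ℕ) < m - 1 := by
      have h2 : (a : ℕ) ≠ m - 1 := fun h => ha (Fin.ext h)
      omega
    rw [Function.update_of_ne ha]
    simp [appendLast, h1]

/-- The minors of a sequence of vectors satisfy the Plücker relations. -/
lemma pluckerExpr_seqMinor (hm : 0 < m) (v : ℤ → Fin m → A)
    (i : Fin (m - 1) ↪o ℤ) (j : Fin (m + 1) ↪o ℤ) :
    pluckerExpr (fun I : Idx m => seqMinor v I) i j = 0 := by
  unfold pluckerExpr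
  simp only [altExt_seqMinor]
  let φ := rowMap v (appendLast i 0) ⟨m - 1, by omega⟩
  have hφ : ∀ s : ℤ, φ (v s) = seqMinor v (appendLast i s) := fun s => by
    rw [rowMap_seq, update_appendLast hm]
  have h := congrArg φ (sum_smul_det (fun t : Fin (m + 1) => v (j t)))
  rw [map_sum, map_zero] at h
  rw [← neg_eq_zero, ← Finset.sum_neg_distrib, ← h]
  refine Finset.sum_congr rfl fun t _ => ?_
  rw [map_smul, hφ, smul_eq_mul, pow_succ]
  change _ = (-1) ^ (t : ℕ) * seqMinor v (fun k => j (t.succAbove k)) * _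
  ring

end Pluecker

/-! ### Solutions of the Plücker relations are minors -/

section Solutions

variable {m : ℕ} {A : Type*} [CommRing A]

/-- The tuple `(1, …, m)`. -/
def baseIdx (m : ℕ) : Fin m → ℤ := fun a => 1 + (a : ℤ)

lemma altExt_update_baseIdx (x : Idx m → A) (a c : Fin m) :
    altExt x (Function.update (baseIdx m) a (baseIdx m c)) =
      if a = c then altExt x (baseIdx m) else 0 := by
  split_ifs with h
  · rw [h, Function.update_eq_self]
  · refine altExt_of_not_injective x fun hinj => h (hinj ?_)
    rw [Function.update_self, Function.update_of_ne (Ne.symm h)]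

/-- For k outside [1, m] this is the Plücker relation for the m + 1 indices 1, …, m, k in increasing
order; the signs come from moving k into place a. For k in [1, m] only one summand survives, and it
equals the left side. -/
lemma exchange_of_increasing (hm : 0 < m) {x : Idx m → A} (hx : ∀ i j, pluckerExpr x i j = 0)
    (i : Fin (m - 1) ↪o ℤ) (k : ℤ) :
    altExt x (baseIdx m) * altExt x (appendLast i k) =
      ∑ a, altExt x (Function.update (baseIdx m) a k) * altExt x (appendLast i (baseIdx m a)) := by
  have : NeZero m := ⟨by omega⟩
  rcases lt_or_ge k 1 with hk | hk
  · let j : Fin (m + 1) ↪o ℤ := OrderEmbedding.ofStrictMono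
      (fun t : Fin (m + 1) => if (t : ℕ) = 0 then k else (t : ℤ)) (fun s t hst => by
        have : (s : ℕ) < t := hst
        dsimp only
        split_ifs <;> omega)
    have hj : ∀ t : Fin (m + 1), j t = if (t : ℕ) = 0 then k else (t : ℤ) := fun t => rfl
    have h := hx i j
    unfold pluckerExpr at h
    rw [Fin.sum_univ_succ] at h
    have e0 : (fun a : Fin m => j ((0 : Fin (m + 1)).succAbove a)) = baseIdx m := by
      funext a
      rw [Fin.succAbove_zero, hj, if_neg (by simp), Fin.val_succ, baseIdx]
      push_cast
      ring
    have e1 : ∀ a : Fin m, altExt x (Function.update (baseIdx m) a k) =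
        (-1) ^ (a : ℕ) * altExt x (fun b : Fin m => j (a.succ.succAbove b)) := fun a => by
      -- The index k < 1 stands first and passes a entries.
      have hp := altExt_perm x (fun b : Fin m => j (a.succ.succAbove b)) (Fin.cycleRange a)
      rw [Fin.sign_cycleRange] at hp
      push_cast at hp
      rw [← hp]
      congr 1
      funext b
      rw [hj]
      rcases lt_trichotomy b a with hb | hb | hb
      · have hv : ((Fin.cycleRange a b : Fin m) : ℕ) = b + 1 := Fin.coe_cycleRange_of_lt hb
        have hs : ((a.succ.succAbove (Fin.cycleRange a b)) : ℕ) = b + 1 := by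
          rw [Fin.succAbove_of_castSucc_lt _ _ (by
            rw [Fin.lt_def, Fin.val_castSucc, hv, Fin.val_succ]
            have : (b : ℕ) < a := hb
            omega), Fin.val_castSucc, hv]
        rw [Function.update_of_ne hb.ne, hs, if_neg (by omega), baseIdx]
        push_cast
        ring
      · subst hb
        rw [Function.update_self, Fin.cycleRange_self, Fin.succ_succAbove_zero]
        simp
      · have hs : ((a.succ.succAbove (Fin.cycleRange a b)) : ℕ) = b + 1 := by
          rw [Fin.cycleRange_of_gt hb, Fin.succAbove_of_le_castSucc _ _ (by
            rw [Fin.le_def, Fin.val_castSucc, Fin.val_succ]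
            have : (a : ℕ) < b := hb
            omega), Fin.val_succ]
        rw [Function.update_of_ne hb.ne', hs, if_neg (by omega), baseIdx]
        push_cast
        ring
    have e2 : ∀ a : Fin m, j a.succ = baseIdx m a := fun a => by
      rw [hj, if_neg (by simp), Fin.val_succ, baseIdx]
      push_cast
      ring
    have e3 : j 0 = k := by simp [hj]
    rw [e0, e3, add_eq_zero_iff_eq_neg, ← Finset.sum_neg_distrib, Fin.val_zero] at h
    have h' := congrArg Neg.neg h
    rw [← Finset.sum_neg_distrib] at h'
    convert h' using 1
    · ring
    · refine Finset.sum_congr rfl fun a _ => ?_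
      rw [e1, e2, Fin.val_succ]
      ring
  rcases lt_or_ge (m : ℤ) k with hk' | hk'
  · let j : Fin (m + 1) ↪o ℤ := OrderEmbedding.ofStrictMono
      (fun t : Fin (m + 1) => if (t : ℕ) = m then k else 1 + (t : ℤ)) (fun s t hst => by
        have : (s : ℕ) < t := hst
        have := t.2
        dsimp only
        split_ifs <;> omega)
    have hj : ∀ t : Fin (m + 1), j t = if (t : ℕ) = m then k else 1 + (t : ℤ) := fun t => rfl
    let l : Fin m := ⟨m - 1, by omega⟩
    have h := hx i j
    unfold pluckerExpr at h
    rw [Fin.sum_univ_castSucc] at h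
    have e0 : (fun a : Fin m => j ((Fin.last m).succAbove a)) = baseIdx m := by
      funext a
      rw [Fin.succAbove_last, hj, Fin.val_castSucc, if_neg a.2.ne, baseIdx]
    have e1 : ∀ a : Fin m, altExt x (fun b : Fin m => j (a.castSucc.succAbove b)) =
        (-1) ^ (m - 1 - a) * altExt x (Function.update (baseIdx m) a k) := fun a => by
      have hal : a ≤ l := by
        rw [Fin.le_def]
        change (a : ℕ) ≤ m - 1
        omega
      -- The index k > m stands last and passes m - 1 - a entries.
      have hp := altExt_perm x (Function.update (baseIdx m) a k) (Fin.cycleIcc a l)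
      rw [Fin.sign_cycleIcc_of_le hal] at hp
      push_cast at hp
      change _ = (-1) ^ (m - 1 - (a : ℕ)) * _ at hp
      rw [← hp]
      congr 1
      funext b
      rw [hj]
      rcases lt_or_ge b a with hb | hb
      · rw [Fin.cycleIcc_of_lt hb, Function.update_of_ne hb.ne, Fin.succAbove_of_castSucc_lt _ _ hb,
          Fin.val_castSucc, if_neg b.2.ne, baseIdx]
      · rw [Fin.succAbove_of_le_castSucc _ _ hb, Fin.val_succ]
        by_cases hbl : b = l
        · subst hbl
          rw [Fin.cycleIcc_of_last hal, Function.update_self, if_pos (by simp [l]; omega)]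
        · have hbl' : (b : ℕ) + 1 < m := by
            have : (b : ℕ) ≠ m - 1 := fun e => hbl (Fin.ext e)
            omega
          have hbl2 : b < l := by
            rw [Fin.lt_def]
            change (b : ℕ) < m - 1
            omega
          have hv : ((b + 1 : Fin m) : ℕ) = b + 1 := Fin.val_add_one_of_lt' hbl'
          have hne : b + 1 ≠ a := fun e => by
            have h1 : (a : ℕ) ≤ b := hb
            have h2 := congrArg Fin.val e
            omega
          rw [Fin.cycleIcc_of_ge_of_lt hb hbl2, Function.update_of_ne hne, if_neg (by omega),
            baseIdx, hv]
    have e2 : ∀ a : Fin m, j a.castSucc = baseIdx m a := fun a => by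
      rw [hj, Fin.val_castSucc, if_neg a.2.ne, baseIdx]
    have e3 : j (Fin.last m) = k := if_pos (by simp)
    rw [e0, e3, Fin.val_last] at h
    have e4 : ∀ a : Fin m, (-1 : A) ^ ((a.castSucc : ℕ) + 1) *
        (altExt x (appendLast i (j a.castSucc)) *
          altExt x (fun b : Fin m => j (a.castSucc.succAbove b))) =
        (-1) ^ m * (altExt x (Function.update (baseIdx m) a k) *
          altExt x (appendLast i (baseIdx m a))) := fun a => by
      rw [e1, e2, Fin.val_castSucc]
      have hpow : (-1 : A) ^ m = (-1) ^ ((a : ℕ) + 1) * (-1) ^ (m - 1 - a) := by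
        rw [← pow_add]
        congr 1
        omega
      rw [hpow]
      ring
    rw [Finset.sum_congr rfl fun a _ => e4 a, ← Finset.mul_sum] at h
    have hs : (-1 : A) ^ m * (-1) ^ m = 1 := by
      rw [← mul_pow]
      simp
    rw [pow_succ] at h
    linear_combination (-(-1 : A) ^ m) * h + (∑ a, altExt x (Function.update (baseIdx m) a k) *
      altExt x (appendLast i (baseIdx m a)) -
        altExt x (baseIdx m) * altExt x (appendLast i k)) * hs
  · obtain ⟨c, rfl⟩ : ∃ c : Fin m, k = baseIdx m c :=
      ⟨⟨(k - 1).toNat, by omega⟩, by simp [baseIdx]; omega⟩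
    simp [altExt_update_baseIdx]

lemma sign_isUnit (A : Type*) [CommRing A] (π : Equiv.Perm (Fin m)) :
    IsUnit ((Equiv.Perm.sign π : ℤ) : A) := IsUnit.of_mul_eq_one _ (sign_sq A π)

/-- The permutation does not depend on j, so its sign is a common factor of all terms of an exchange
relation and can be cancelled. -/
lemma exists_perm_appendLast (i : Fin (m - 1) → ℤ) (σ : Equiv.Perm (Fin (m - 1))) :
    ∃ π : Equiv.Perm (Fin m), ∀ j, appendLast (fun a => i (σ a)) j = fun a => appendLast i j (π a) := by
  have key : ∀ (σ τ : Equiv.Perm (Fin (m - 1))), (∀ a, τ (σ a) = a) → ∀ a : Fin m,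
      (fun a : Fin m => if h : (a : ℕ) < m - 1 then (τ ⟨a, h⟩).castLE (Nat.sub_le m 1) else a)
        ((fun a : Fin m => if h : (a : ℕ) < m - 1 then
          (σ ⟨a, h⟩).castLE (Nat.sub_le m 1) else a) a) = a := by
    intro σ τ h a
    by_cases ha : (a : ℕ) < m - 1
    · simp [ha, h]
    · simp [ha]
  refine ⟨⟨fun a => if h : (a : ℕ) < m - 1 then (σ ⟨a, h⟩).castLE (Nat.sub_le m 1) else a,
    fun a => if h : (a : ℕ) < m - 1 then (σ.symm ⟨a, h⟩).castLE (Nat.sub_le m 1) else a,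
    key σ σ.symm (by simp), key σ.symm σ (by simp)⟩, fun j => ?_⟩
  funext a
  by_cases ha : (a : ℕ) < m - 1
  · simp [appendLast, ha]
  · simp [appendLast, ha]

lemma exchange_last (hm : 0 < m) {x : Idx m → A} (hx : ∀ i j, pluckerExpr x i j = 0)
    (i : Fin (m - 1) → ℤ) (k : ℤ) :
    altExt x (baseIdx m) * altExt x (appendLast i k) =
      ∑ a, altExt x (Function.update (baseIdx m) a k) * altExt x (appendLast i (baseIdx m a)) := by
  by_cases hi : Function.Injective i
  · have h := exchange_of_increasing hm hx (sortIdx i hi) k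
    obtain ⟨π, hπ⟩ := exists_perm_appendLast i (Tuple.sort i)
    have hs : ∀ j, altExt x (appendLast (sortIdx i hi) j) =
        ((Equiv.Perm.sign π : ℤ) : A) * altExt x (appendLast i j) := fun j => by
      rw [← altExt_perm, ← hπ]
      rfl
    simp only [hs] at h
    simp only [fun y z : A => mul_left_comm y ((Equiv.Perm.sign π : ℤ) : A) z,
      ← Finset.mul_sum] at h
    exact (sign_isUnit A π).mul_left_cancel h
  · have h0 : ∀ j, altExt x (appendLast i j) = 0 := fun j =>
      altExt_of_not_injective x fun hinj => hi fun a b hab => by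
        have := @hinj (a.castLE (Nat.sub_le m 1)) (b.castLE (Nat.sub_le m 1)) (by
          simp [appendLast, hab])
        simpa using this
    simp [h0]

/-- The exchange relation in place `b`. -/
lemma exchange (hm : 0 < m) {x : Idx m → A} (hx : ∀ i j, pluckerExpr x i j = 0)
    (f : Fin m → ℤ) (b : Fin m) :
    altExt x (baseIdx m) * altExt x f =
      ∑ a, altExt x (Function.update (baseIdx m) a (f b)) *
        altExt x (Function.update f b (baseIdx m a)) := by
  let l : Fin m := ⟨m - 1, by omega⟩
  let i : Fin (m - 1) → ℤ := fun a => f (Equiv.swap b l (a.castLE (Nat.sub_le m 1)))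
  have hs : ∀ j, altExt x (appendLast i j) =
      ((Equiv.Perm.sign (Equiv.swap b l) : ℤ) : A) * altExt x (Function.update f b j) := fun j => by
    rw [← altExt_perm]
    congr 1
    funext a
    by_cases ha : a = l
    · subst ha
      simp [appendLast, l]
    · have h1 : (a : ℕ) < m - 1 := by
        have h2 : (a : ℕ) ≠ m - 1 := fun h => ha (Fin.ext h)
        omega
      have h2 : Equiv.swap b l a ≠ b := fun h => ha ((Equiv.swap b l).injective (by
        rw [h, Equiv.swap_apply_right]))
      rw [Function.update_of_ne h2]
      simp [appendLast, h1, i]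
  have h := exchange_last hm hx i (f b)
  simp only [hs, Function.update_eq_self] at h
  simp only [fun y z : A => mul_left_comm y ((Equiv.Perm.sign (Equiv.swap b l) : ℤ) : A) z,
    ← Finset.mul_sum] at h
  exact (sign_isUnit A _).mul_left_cancel h

/-- Vectors whose minors are a given solution of the Plücker relations. -/
def pluckerVec (x : Idx m → A) (k : ℤ) (a : Fin m) : A :=
  -- The quotients below send the tuple (1, …, m) to the standard basis, of determinant 1. Rescaling
  -- one coordinate by P_{1,…,m} multiplies every minor by it and restores the right normalization.
  (if (a : ℕ) = 0 then altExt x (baseIdx m) else 1) *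
    (Ring.inverse (altExt x (baseIdx m)) * altExt x (Function.update (baseIdx m) a k))

/-- Both sides obey the same expansion when an entry f b is replaced by 1, …, m: the minor by
linearity, the solution by `exchange`. Induction on the number of entries outside [1, m] reduces to
tuples from [1, m], which are permutations of the base tuple or have a repetition. -/
lemma seqMinor_normalized (hm : 0 < m) {x : Idx m → A} (hx : ∀ i j, pluckerExpr x i j = 0)
    (hu : IsUnit (altExt x (baseIdx m))) (f : Fin m → ℤ) :
    altExt x (baseIdx m) * seqMinor (fun k a => Ring.inverse (altExt x (baseIdx m)) *
      altExt x (Function.update (baseIdx m) a k)) f = altExt x f := by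
  set D := altExt x (baseIdx m) with hD
  set u : ℤ → Fin m → A := fun k a => Ring.inverse D * altExt x (Function.update (baseIdx m) a k)
    with hud
  have hDi : Ring.inverse D * D = 1 := Ring.inverse_mul_cancel _ hu
  have hbase : ∀ c : Fin m, u (baseIdx m c) = Pi.single c 1 := fun c => by
    funext a
    simp only [hud, altExt_update_baseIdx, Pi.single_apply]
    split_ifs
    · exact hDi
    · exact mul_zero _
  have hexch : ∀ f b, altExt x f = ∑ a, u (f b) a * altExt x (Function.update f b (baseIdx m a)) :=
    fun f b => by
      have h := congrArg (fun y => Ring.inverse D * y) (exchange hm hx f b)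
      simp only [← mul_assoc, Finset.mul_sum, ← hD, hDi, one_mul] at h
      exact h
  have hlin : ∀ f b, seqMinor u f =
      ∑ a, u (f b) a * seqMinor u (Function.update f b (baseIdx m a)) := fun f b => by
    have h1 : u (f b) = ∑ a, u (f b) a • u (baseIdx m a) := by
      simp only [hbase]
      exact pi_eq_sum_univ' (u (f b))
    have h2 : seqMinor u f = rowMap u f b (u (f b)) := by
      rw [rowMap_seq, Function.update_eq_self]
    rw [h2]
    conv_lhs => rw [h1]
    rw [map_sum]
    refine Finset.sum_congr rfl fun a _ => ?_
    rw [map_smul, rowMap_seq, smul_eq_mul]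
  have key : ∀ n : ℕ, ∀ f : Fin m → ℤ,
      (Finset.univ.filter fun b => ∀ c, f b ≠ baseIdx m c).card ≤ n →
        D * seqMinor u f = altExt x f := by
    intro n
    induction n with
    | zero =>
      intro f hf
      have hf' : ∀ b, ∃ c, f b = baseIdx m c := fun b => by
        have := Finset.card_eq_zero.mp (Nat.le_zero.mp hf)
        rw [Finset.filter_eq_empty_iff] at this
        simpa using this (Finset.mem_univ b)
      choose g hg using hf'
      obtain rfl : f = fun b => baseIdx m (g b) := funext hg
      by_cases hinj : Function.Injective g
      · obtain ⟨π, rfl⟩ : ∃ π : Equiv.Perm (Fin m), g = π :=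
          ⟨Equiv.ofBijective g (Finite.injective_iff_bijective.mp hinj), rfl⟩
        have h1 : seqMinor u (baseIdx m) = 1 := by
          unfold seqMinor
          simp only [hbase]
          convert Matrix.det_one (n := Fin m) (R := A)
          ext a b
          simp [Matrix.one_apply, Pi.single_apply, eq_comm]
        rw [altExt_perm, seqMinor_perm, h1, mul_one, mul_comm]
      · rw [altExt_of_not_injective x fun h => hinj fun a b hab => h (by simp only [hab])]
        simp only [Function.Injective, not_forall] at hinj
        obtain ⟨a, b, hab, hne⟩ := hinj
        rw [seqMinor, Matrix.det_zero_of_row_eq hne, mul_zero]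
        funext c
        simp [hab]
    | succ n ih =>
      intro f hf
      by_cases hall : ∀ b, ∃ c, f b = baseIdx m c
      · refine ih f (le_trans (le_of_eq ?_) (Nat.zero_le n))
        rw [Finset.card_eq_zero, Finset.filter_eq_empty_iff]
        simpa using hall
      · push Not at hall
        obtain ⟨b, hb⟩ := hall
        rw [hlin f b, hexch f b, Finset.mul_sum]
        refine Finset.sum_congr rfl fun a _ => ?_
        rw [mul_left_comm, ih]
        have hlt : (Finset.univ.filter fun b' => ∀ c,
            Function.update f b (baseIdx m a) b' ≠ baseIdx m c).card <
            (Finset.univ.filter fun b' => ∀ c, f b' ≠ baseIdx m c).card := by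
          refine Finset.card_lt_card (Finset.ssubset_iff_of_subset ?_ |>.mpr ⟨b, ?_, ?_⟩)
          · intro b' hb'
            simp only [Finset.mem_filter, Finset.mem_univ, true_and] at hb' ⊢
            by_cases h : b' = b
            · subst h
              exact hb
            · simpa [h] using hb'
          · simpa using hb
          · simp
        omega
  exact key _ f le_rfl

/-- A solution of the Plücker relations with invertible value at `(1, …, m)` consists of the
minors of a sequence of vectors. -/
lemma seqMinor_pluckerVec (hm : 0 < m) {x : Idx m → A} (hx : ∀ i j, pluckerExpr x i j = 0)
    (hu : IsUnit (altExt x (baseIdx m))) (f : Fin m → ℤ) :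
    seqMinor (pluckerVec x) f = altExt x f := by
  have : NeZero m := ⟨by omega⟩
  rw [← seqMinor_normalized hm hx hu f]
  have h := Matrix.det_mul_row
    (fun a : Fin m => if (a : ℕ) = 0 then altExt x (baseIdx m) else 1)
    (Matrix.of fun b a => Ring.inverse (altExt x (baseIdx m)) *
      altExt x (Function.update (baseIdx m) a (f b)))
  refine Eq.trans h ?_
  congr 1
  rw [Finset.prod_eq_single 0]
  · simp
  · intro b _ hb
    exact if_neg fun e => hb (Fin.ext (by simpa using e))
  · simp

end Solutions

/-! ### The endomorphisms of `Gr_m` -/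

section Endomorphisms

variable {m : ℕ}

/-- The tuple `(k, k+1, …, k+m-1)`. -/
def consecIdx (m : ℕ) (k : ℤ) : Idx m :=
  OrderEmbedding.ofStrictMono (fun a => k + (a : ℤ)) (fun a b h => by
    have : (a : ℕ) < b := h
    dsimp only
    omega)

lemma consecIdx_isFrozen (k : ℤ) : IsFrozen (consecIdx m k) := ⟨k, fun _ => rfl⟩

lemma IsFrozen.exists_eq {I : Idx m} (hI : IsFrozen I) : ∃ k, I = consecIdx m k := by
  obtain ⟨k, hk⟩ := hI
  exact ⟨k, by ext a; exact hk a⟩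

lemma gr_algHom_ext {A : Type*} [CommRing A] [Algebra ℂ A] {φ ψ : Gr m →ₐ[ℂ] A}
    (h : ∀ I, φ (P I) = ψ (P I)) : φ = ψ := by
  refine Ideal.Quotient.algHom_ext ℂ ?_
  refine IsLocalization.algHom_ext (frozenMonoid m) (MvPolynomial.algHom_ext fun I => ?_)
  exact h I

lemma grBar_algHom_ext {A : Type*} [CommRing A] [Algebra ℂ A] {φ ψ : GrBar m →ₐ[ℂ] A}
    (h : ∀ I, φ (proj m (P I)) = ψ (proj m (P I))) : φ = ψ :=
  Ideal.Quotient.algHom_ext ℂ (gr_algHom_ext (φ := φ.comp (proj m)) (ψ := ψ.comp (proj m)) h)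

/-- A sequence of vectors over `Gr_m` whose minors are the Plücker coordinates. -/
def univSeq (m : ℕ) : ℤ → Fin m → Gr m := pluckerVec P

lemma seqMinor_univSeq (hm : 0 < m) (f : Fin m → ℤ) : seqMinor (univSeq m) f = altExt P f :=
  seqMinor_pluckerVec hm pluckerExpr_P (by
    have h := altExt_coe (P (m := m)) (consecIdx m 1)
    change altExt P (baseIdx m) = _ at h
    rw [h]
    exact isUnit_P (consecIdx_isFrozen 1)) f

lemma seqMinor_univSeq_coe (hm : 0 < m) (I : Idx m) : seqMinor (univSeq m) I = P I := by
  rw [seqMinor_univSeq hm, altExt_coe]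

lemma consecMinor_univSeq (hm : 0 < m) (k : ℤ) :
    consecMinor (univSeq m) k = P (consecIdx m k) := seqMinor_univSeq_coe hm (consecIdx m k)

lemma unitConsec_univSeq (hm : 0 < m) : UnitConsec (univSeq m) := fun k => by
  rw [consecMinor_univSeq hm]
  exact isUnit_P (consecIdx_isFrozen k)

/-- The endomorphism of `Gr_m` that sends `P_I` to the minor `I` of the exchanged sequence. -/
def grBraid (hm : 1 < m) (i : ℕ) : Gr m →ₐ[ℂ] Gr m :=
  grLift (fun I => seqMinor (kappaOver i (univSeq m)) I)
    (fun I hI => by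
      obtain ⟨k, rfl⟩ := hI.exists_eq
      exact (unitConsec_univSeq (by omega)).kappaOver hm i k)
    (fun a b => pluckerExpr_seqMinor (by omega) _ a b)

lemma grBraid_P (hm : 1 < m) (i : ℕ) (I : Idx m) :
    grBraid hm i (P I) = seqMinor (kappaOver i (univSeq m)) I := grLift_P _ _ _ I

/-- If a homomorphism maps the Plücker coordinates to the minors of a sequence, then it maps the
vectors of the universal sequence to a sequence with the same minors. -/
lemma seqMinor_mapSeq_univSeq (hm : 0 < m) {A : Type*} [CommRing A] (φ : Gr m →+* A)
    {v : ℤ → Fin m → A} (h : ∀ I : Idx m, φ (P I) = seqMinor v I) (f : Fin m → ℤ) :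
    seqMinor (mapSeq φ (univSeq m)) f = seqMinor v f := by
  rw [seqMinor_mapSeq, seqMinor_univSeq hm, altExt_map, ← altExt_seqMinor v]
  congr 1
  exact funext h

/-- The image of the universal sequence need not be v, but it has the same minors, and that
suffices. Composites, shifts and evaluation at configurations are all treated through this
statement. -/
lemma map_seqMinor_kappaOver (hm : 1 < m) {A : Type*} [CommRing A] (φ : Gr m →+* A)
    {v : ℤ → Fin m → A} (h : ∀ I : Idx m, φ (P I) = seqMinor v I) (i : ℕ) (f : Fin m → ℤ) :
    φ (seqMinor (kappaOver i (univSeq m)) f) = seqMinor (kappaOver i v) f := by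
  rw [← seqMinor_mapSeq, ← kappaOver_mapSeq φ (unitConsec_univSeq (by omega))]
  exact seqMinor_kappaOver_congr (seqMinor_mapSeq_univSeq (by omega) φ h) i f

/-- Substitution is contravariant, so the order of the exchanges is reversed; both sides of each
braid relation are preserved or interchanged by this reversal. -/
lemma grBraid_comp_P (hm : 1 < m) (i j : ℕ) (I : Idx m) :
    grBraid hm i (grBraid hm j (P I)) = seqMinor (kappaOver j (kappaOver i (univSeq m))) I := by
  rw [grBraid_P]
  exact map_seqMinor_kappaOver hm (grBraid hm i : Gr m →+* Gr m) (grBraid_P hm i) j I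

lemma grBraid_comp_comp_P (hm : 1 < m) (i j k : ℕ) (I : Idx m) :
    grBraid hm i (grBraid hm j (grBraid hm k (P I))) =
      seqMinor (kappaOver k (kappaOver j (kappaOver i (univSeq m)))) I := by
  rw [grBraid_P]
  exact map_seqMinor_kappaOver hm (((grBraid hm i).comp (grBraid hm j) : Gr m →ₐ[ℂ] Gr m) :
    Gr m →+* Gr m) (grBraid_comp_P hm i j) k I

lemma grBraid_braid (hm : 2 < m) (i : ℕ) (x : Gr m) :
    grBraid (m := m) (by omega) i (grBraid (by omega) (i + 1) (grBraid (by omega) i x)) =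
      grBraid (by omega) (i + 1) (grBraid (by omega) i (grBraid (by omega) (i + 1) x)) := by
  have hm1 : 1 < m := by omega
  have h : ((grBraid hm1 i).comp (grBraid hm1 (i + 1))).comp (grBraid hm1 i) =
      ((grBraid hm1 (i + 1)).comp (grBraid hm1 i)).comp (grBraid hm1 (i + 1)) :=
    gr_algHom_ext fun I => by
      change grBraid hm1 i (grBraid hm1 (i + 1) (grBraid hm1 i (P I))) =
        grBraid hm1 (i + 1) (grBraid hm1 i (grBraid hm1 (i + 1) (P I)))
      rw [grBraid_comp_comp_P, grBraid_comp_comp_P,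
        kappaOver_braid hm (unitConsec_univSeq (by omega))]
  exact congrArg (fun φ : Gr m →ₐ[ℂ] Gr m => φ x) h

lemma grBraid_comm (hm : 1 < m) {i j : ℕ} (h1 : 1 ≤ i) (h2 : i + 1 < j) (h3 : j < m) (x : Gr m) :
    grBraid hm i (grBraid hm j x) = grBraid hm j (grBraid hm i x) := by
  have h : (grBraid hm i).comp (grBraid hm j) = (grBraid hm j).comp (grBraid hm i) :=
    gr_algHom_ext fun I => by
      change grBraid hm i (grBraid hm j (P I)) = grBraid hm j (grBraid hm i (P I))
      rw [grBraid_comp_P, grBraid_comp_P, kappaOver_comm hm _ _ _ (unitConsec_univSeq (by omega))]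
      -- The bounds 1 ≤ i and j < m exclude i = 0, j = m - 1, which are neighbours modulo m.
      all_goals exact not_dvd_of_abs_lt (by omega) (by omega) (by omega)
  exact congrArg (fun φ : Gr m →ₐ[ℂ] Gr m => φ x) h

lemma grBraid_sh (hm : 1 < m) (i : ℕ) (x : Gr m) :
    grBraid hm i (sh m m x) = sh m m (grBraid hm i x) := by
  have h : (grBraid hm i).comp (sh m m) = (sh m m).comp (grBraid hm i) :=
    gr_algHom_ext fun I => by
      change grBraid hm i (sh m m (P I)) = sh m m (grBraid hm i (P I))
      rw [sh_P, grBraid_P, grBraid_P]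
      have h1 := map_seqMinor_kappaOver hm (sh m m : Gr m →+* Gr m)
        (v := fun k => univSeq m (k + m)) (fun J => by
          change sh m m (P J) = _
          rw [sh_P, ← seqMinor_univSeq_coe (by omega)]
          rfl) i I
      refine Eq.trans ?_ h1.symm
      unfold seqMinor
      congr 2
      funext a
      exact (kappaOver_shift i (univSeq m) (I a)).symm
  exact congrArg (fun φ : Gr m →ₐ[ℂ] Gr m => φ x) h

/-! ### Passage to the quotient in which consecutive coordinates are 1 -/

/-- A consecutive minor of the exchanged sequence is either an old one or satisfies Δ_k Δ'_k =
Δ_{k-1} Δ_{k+1}, and all old ones project to 1. -/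
lemma proj_grBraid_P (hm : 1 < m) (i : ℕ) {I : Idx m} (hI : IsFrozen I) :
    proj m (grBraid hm i (P I)) = 1 := by
  obtain ⟨k, rfl⟩ := hI.exists_eq
  have hU := unitConsec_univSeq (m := m) (by omega)
  have hone : ∀ l, proj m (consecMinor (univSeq m) l) = 1 := fun l => by
    rw [consecMinor_univSeq (by omega)]
    exact proj_eq_one (consecIdx_isFrozen l)
  rw [grBraid_P]
  change proj m (consecMinor (kappaOver i (univSeq m)) k) = 1
  obtain ⟨p, h1, h2, hp⟩ := exists_dvd_window (m := m) (by omega) i k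
  by_cases h3 : p + 1 < k + m
  · rw [consecMinor_kappaOver_of_dvd hm hp h1 h3]
    exact hone k
  · have hp' : (m : ℤ) ∣ (k - 1) - i := by
      rw [show k - 1 - (i : ℤ) = p - i - m by omega]
      exact dvd_sub hp dvd_rfl
    have h := congrArg (proj m) (consecMinor_kappaOver_succ hm hp' (hU _))
    simpa only [map_mul, hone, one_mul, sub_add_cancel] using h

/-- The endomorphism of `\bar Gr_m` induced by `grBraid`. -/
def grBarBraid (hm : 1 < m) (i : ℕ) : GrBar m →ₐ[ℂ] GrBar m :=
  Ideal.Quotient.liftₐ (frozenIdeal m) ((proj m).comp (grBraid hm i)) (by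
    suffices h : frozenIdeal m ≤ RingHom.ker ((proj m).comp (grBraid hm i)) from fun a ha => h ha
    refine Ideal.span_le.mpr ?_
    rintro _ ⟨I, hI, rfl⟩
    change proj m (grBraid hm i (P I - 1)) = 0
    rw [map_sub, map_sub, map_one, map_one, proj_grBraid_P hm i hI, sub_self])

lemma grBarBraid_proj (hm : 1 < m) (i : ℕ) (x : Gr m) :
    grBarBraid hm i (proj m x) = proj m (grBraid hm i x) := rfl

lemma shBar_proj (t : ℤ) (x : Gr m) : shBar m t (proj m x) = proj m (sh m t x) := rfl

lemma proj_surjective : Function.Surjective (proj m) := Ideal.Quotient.mk_surjective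

lemma grBarBraid_braid (hm : 2 < m) (i : ℕ) (z : GrBar m) :
    grBarBraid (m := m) (by omega) i (grBarBraid (by omega) (i + 1) (grBarBraid (by omega) i z)) =
      grBarBraid (by omega) (i + 1)
        (grBarBraid (by omega) i (grBarBraid (by omega) (i + 1) z)) := by
  obtain ⟨x, rfl⟩ := proj_surjective z
  simp only [grBarBraid_proj, grBraid_braid hm]

lemma grBarBraid_comm (hm : 1 < m) {i j : ℕ} (h1 : 1 ≤ i) (h2 : i + 1 < j) (h3 : j < m)
    (z : GrBar m) : grBarBraid hm i (grBarBraid hm j z) = grBarBraid hm j (grBarBraid hm i z) := by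
  obtain ⟨x, rfl⟩ := proj_surjective z
  simp only [grBarBraid_proj, grBraid_comm hm h1 h2 h3]

lemma grBarBraid_shBar (hm : 1 < m) (i : ℕ) (z : GrBar m) :
    grBarBraid hm i (shBar m m z) = shBar m m (grBarBraid hm i z) := by
  obtain ⟨x, rfl⟩ := proj_surjective z
  simp only [grBarBraid_proj, shBar_proj, grBraid_sh hm]

lemma shBar_shBar (s t : ℤ) (z : GrBar m) : shBar m s (shBar m t z) = shBar m (t + s) z := by
  have h : (shBar m s).comp (shBar m t) = shBar m (t + s) := grBar_algHom_ext fun I => by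
    change shBar m s (shBar m t (proj m (P I))) = _
    rw [shBar_P, shBar_P, shBar_P]
    congr 2
    ext a
    exact add_assoc _ _ _
  exact congrArg (fun φ : GrBar m →ₐ[ℂ] GrBar m => φ z) h

lemma shBar_zero (z : GrBar m) : shBar m 0 z = z := by
  have h : shBar m 0 = AlgHom.id ℂ (GrBar m) := grBar_algHom_ext fun I => by
    rw [shBar_P]
    change proj m (P (I.shift 0)) = proj m (P I)
    congr 2
    ext a
    exact add_zero _
  exact congrArg (fun φ : GrBar m →ₐ[ℂ] GrBar m => φ z) h

lemma grBarBraid_shBar_mul (hm : 1 < m) (i t : ℕ) (z : GrBar m) :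
    grBarBraid hm i (shBar m ((m * t : ℕ) : ℤ) z) = shBar m ((m * t : ℕ) : ℤ) (grBarBraid hm i z) := by
  induction t with
  | zero => simp [shBar_zero]
  | succ t ih =>
    have h : ∀ y : GrBar m, shBar m ((m * (t + 1) : ℕ) : ℤ) y =
        shBar m m (shBar m ((m * t : ℕ) : ℤ) y) := fun y => by
      rw [shBar_shBar]
      congr 1
    rw [h, h, grBarBraid_shBar, ih]

end Endomorphisms

/-! ### Generators and finite levels -/

section Levels

variable {m : ℕ}

lemma GrOn_mono {S T : Set ℤ} (h : S ⊆ T) : GrOn m S ≤ GrOn m T := by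
  refine Algebra.adjoin_mono (Set.union_subset_union ?_ ?_)
  · rintro _ ⟨I, hI, rfl⟩
    exact ⟨I, fun k => h (hI k), rfl⟩
  · rintro y ⟨J, hJ, hJS, hy⟩
    exact ⟨J, hJ, fun k => h (hJS k), hy⟩

lemma altExt_mem_GrOn {S : Set ℤ} {f : Fin m → ℤ} (hf : ∀ a, f a ∈ S) : altExt P f ∈ GrOn m S := by
  unfold altExt
  split_ifs with h
  · refine Subalgebra.mul_mem _ ?_ (Algebra.subset_adjoin (Or.inl ⟨_, fun k => hf _, rfl⟩))
    exact intCast_mem _ _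
  · exact zero_mem _

lemma inverse_mem_GrOn {S : Set ℤ} {k : ℤ} (hk : ∀ l, k ≤ l → l < k + m → l ∈ S) :
    Ring.inverse (P (consecIdx m k)) ∈ GrOn m S :=
  Algebra.subset_adjoin (Or.inr ⟨consecIdx m k, consecIdx_isFrozen k,
    fun a => hk _ (le_add_of_nonneg_right (by positivity)) (by
      change k + (a : ℤ) < k + m
      omega),
    Ring.inverse_mul_cancel _ (isUnit_P (consecIdx_isFrozen k))⟩)

lemma consecMinor_mem_GrOn (hm : 0 < m) {S : Set ℤ} {k : ℤ}
    (hk : ∀ l, k ≤ l → l < k + m → l ∈ S) :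
    consecMinor (univSeq m) k ∈ GrOn m S := by
  rw [consecMinor, seqMinor_univSeq hm]
  exact altExt_mem_GrOn fun a => hk _ (by omega) (by omega)

/-- The condition that the exchanges at places in `S` involve only vectors with index in `T`. -/
def ExchangeWithin (m i : ℕ) (S T : Set ℤ) : Prop :=
  ∀ k ∈ S, k ∈ T ∧ ((m : ℤ) ∣ k - i → k + 1 ∈ T) ∧
    -- The exchange itself reaches only from k - 1 to k + m - 1. Index k + m enters through Δ_{k+1},
    -- which has to be inverted in the image of the inverse of P_{k,…,k+m-1}.
    ((m : ℤ) ∣ k - (i + 1) → ∀ l, k - 1 ≤ l → l ≤ k + m → l ∈ T)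

lemma seqMinor_kappaOver_mem (hm : 1 < m) {i : ℕ} {S T : Set ℤ} (h : ExchangeWithin m i S T)
    {f : Fin m → ℤ} (hf : ∀ a, f a ∈ S) :
    seqMinor (kappaOver i (univSeq m)) f ∈ GrOn m T := by
  rw [seqMinor_kappaOver]
  refine Subalgebra.sum_mem _ fun r _ => Subalgebra.mul_mem _ (Subalgebra.prod_mem _ fun a _ => ?_) ?_
  · obtain ⟨-, -, h3⟩ := h _ (hf a)
    have hs : ∀ s : Fin 2, (![1, 0] : Fin 2 → Gr m) s ∈ GrOn m T := fun s => by
      fin_cases s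
      · exact one_mem _
      · exact zero_mem _
    unfold kappaCoeff
    split_ifs with h4 h5
    · exact hs _
    · have hc : exchCoeff (univSeq m) (f a - 1) ∈ GrOn m T := by
        rw [exchCoeff, consecMinor_univSeq (by omega), seqMinor_univSeq (by omega)]
        refine Subalgebra.mul_mem _ (inverse_mem_GrOn fun l h6 h7 => ?_)
          (altExt_mem_GrOn fun b => ?_)
        · exact h3 h5 l (by omega) (by omega)
        · exact h3 h5 _ (by split_ifs <;> omega) (by split_ifs <;> omega)
      rcases r a with ⟨s, hs⟩
      interval_cases s
      · exact hc
      · exact neg_mem (one_mem _)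
    · exact hs _
  · rw [seqMinor_univSeq (by omega)]
    refine altExt_mem_GrOn fun a => ?_
    obtain ⟨h1, h2, h3⟩ := h _ (hf a)
    unfold kappaIdx
    split_ifs with h4 h5
    · exact h2 h4
    · rcases r a with ⟨s, hs⟩
      interval_cases s
      · exact h1
      · exact h3 h5 _ le_rfl (by
          change f a - 1 ≤ _
          omega)
    · exact h1

lemma eq_mul_of_inverses {A : Type*} [CommRing A] {y c d p q a b : A} (hy : y * c = 1)
    (hd : d * c = p * q) (ha : p * a = 1) (hb : q * b = 1) : y = d * (a * b) := by
  linear_combination (d * (a * b)) * hy - y * a * b * hd - y * ha - y * (p * a) * hb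

/-- Images of the P_I are covered by the expansion. The image of an inverse consecutive coordinate
is the inverse of Δ_k, or Δ_k / (Δ_{k-1} Δ_{k+1}). -/
lemma grBraid_mem (hm : 1 < m) {i : ℕ} {S T : Set ℤ} (h : ExchangeWithin m i S T) {x : Gr m}
    (hx : x ∈ GrOn m S) : grBraid hm i x ∈ GrOn m T := by
  suffices hle : GrOn m S ≤ (GrOn m T).comap (grBraid hm i) from hle hx
  refine Algebra.adjoin_le ?_
  rintro y (⟨I, hI, rfl⟩ | ⟨J, hJ, hJS, hy⟩)
  · change grBraid hm i (P I) ∈ GrOn m T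
    rw [grBraid_P]
    exact seqMinor_kappaOver_mem hm h hI
  · change grBraid hm i y ∈ GrOn m T
    obtain ⟨k, rfl⟩ := hJ.exists_eq
    have hwin : ∀ l, k ≤ l → l < k + m → l ∈ S := fun l h1 h2 => by
      have := hJS ⟨(l - k).toNat, by omega⟩
      change k + ((l - k).toNat : ℤ) ∈ S at this
      rwa [show k + ((l - k).toNat : ℤ) = l by omega] at this
    have hy' := congrArg (grBraid hm i) hy
    rw [map_mul, map_one, grBraid_P] at hy'
    change _ * consecMinor (kappaOver i (univSeq m)) k = 1 at hy'
    have hU := unitConsec_univSeq (m := m) (by omega)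
    have hinv : ∀ l : ℤ, (∀ l', l ≤ l' → l' < l + m → l' ∈ T) →
        Ring.inverse (consecMinor (univSeq m) l) ∈ GrOn m T := fun l hl => by
      rw [consecMinor_univSeq (by omega)]
      exact inverse_mem_GrOn hl
    obtain ⟨p, h1, h2, hp⟩ := exists_dvd_window (m := m) (by omega) i k
    by_cases h3 : p + 1 < k + m
    · rw [consecMinor_kappaOver_of_dvd hm hp h1 h3] at hy'
      rw [left_inv_eq_right_inv hy' (Ring.mul_inverse_cancel _ (hU k))]
      exact hinv k fun l h4 h5 => (h l (hwin l h4 h5)).1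
    · have hp' : (m : ℤ) ∣ (k - 1) - i := by
        rw [show k - 1 - (i : ℤ) = p - i - m by omega]
        exact dvd_sub hp dvd_rfl
      have hk3 := (h k (hwin k le_rfl (by omega))).2.2 (by
        rwa [show k - ((i : ℤ) + 1) = k - 1 - i by ring])
      have hf := consecMinor_kappaOver_succ hm hp' (hU _)
      rw [sub_add_cancel, show k - 1 + 2 = k + 1 by ring] at hf
      have e1 := Ring.mul_inverse_cancel _ (hU (k - 1))
      have e2 := Ring.mul_inverse_cancel _ (hU (k + 1))
      rw [eq_mul_of_inverses hy' hf e1 e2]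
      refine Subalgebra.mul_mem _ (consecMinor_mem_GrOn (by omega) fun l h4 h5 => ?_)
        (Subalgebra.mul_mem _ (hinv _ fun l h4 h5 => ?_) (hinv _ fun l h4 h5 => ?_))
      all_goals exact hk3 l (by omega) (by omega)

/-- Since 1 ≤ i < m, place 1 is never the second member of a pair, so no exchange reaches below 1.
-/
lemma exchangeWithin_Ici {i : ℕ} (h1 : 1 ≤ i) (h2 : i < m) :
    ExchangeWithin m i (Set.Ici 1) (Set.Ici 1) := by
  intro k hk
  simp only [Set.mem_Ici] at hk ⊢
  refine ⟨hk, fun _ => by omega, fun h l hl _ => ?_⟩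
  have : k ≠ 1 := fun e => not_dvd_of_abs_lt (m := m) (d := -i) (by omega) (by omega) (by omega)
    (by rwa [e, show (1 : ℤ) - (i + 1) = -i by ring] at h)
  omega

lemma exchangeWithin_Icc {i n N : ℕ} (h1 : 1 ≤ i) (h2 : i < m) (hn : n + m ≤ N) :
    ExchangeWithin m i (Set.Icc 1 (n : ℤ)) (Set.Icc 1 (N : ℤ)) := by
  intro k hk
  simp only [Set.mem_Icc] at hk ⊢
  refine ⟨by omega, fun _ => by omega, fun h l hl hl' => ?_⟩
  have : k ≠ 1 := fun e => not_dvd_of_abs_lt (m := m) (d := -i) (by omega) (by omega) (by omega)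
    (by rwa [e, show (1 : ℤ) - (i + 1) = -i by ring] at h)
  omega

/-! ### Finite levels and generators -/

lemma exists_mem_GrN {x : Gr m} (hx : x ∈ GrPlus m) : ∃ n : ℕ, x ∈ GrN m n := by
  have hb : ∀ I : Idx m, (∀ k, I k ∈ Set.Ici (1 : ℤ)) →
      ∃ n : ℕ, ∀ k, I k ∈ Set.Icc 1 (n : ℤ) := fun I hI => by
    refine ⟨∑ k, (I k).toNat, fun k => ⟨hI k, ?_⟩⟩
    have := Finset.single_le_sum (f := fun k => (I k).toNat) (fun _ _ => Nat.zero_le _)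
      (Finset.mem_univ k)
    omega
  have hmono : ∀ {n n' : ℕ}, n ≤ n' → GrN m n ≤ GrN m n' := fun h =>
    GrOn_mono (Set.Icc_subset_Icc_right (by exact_mod_cast h))
  induction hx using Algebra.adjoin_induction with
  | mem y hy =>
    rcases hy with ⟨I, hI, rfl⟩ | ⟨J, hJ, hJS, hy⟩
    · obtain ⟨n, hn⟩ := hb I hI
      exact ⟨n, Algebra.subset_adjoin (Or.inl ⟨I, hn, rfl⟩)⟩
    · obtain ⟨n, hn⟩ := hb J hJS
      exact ⟨n, Algebra.subset_adjoin (Or.inr ⟨J, hJ, hn, hy⟩)⟩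
  | algebraMap r => exact ⟨0, Subalgebra.algebraMap_mem _ r⟩
  | add y z _ _ h1 h2 =>
    obtain ⟨n1, h1⟩ := h1
    obtain ⟨n2, h2⟩ := h2
    exact ⟨max n1 n2, add_mem (hmono (le_max_left _ _) h1) (hmono (le_max_right _ _) h2)⟩
  | mul y z _ _ h1 h2 =>
    obtain ⟨n1, h1⟩ := h1
    obtain ⟨n2, h2⟩ := h2
    exact ⟨max n1 n2, mul_mem (hmono (le_max_left _ _) h1) (hmono (le_max_right _ _) h2)⟩

/-- The inverted coordinates are 1 in the quotient, so no inverses are needed as generators. The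
universal property of `Gr m` factors `proj m` through the subalgebra. -/
lemma grBarOn_univ (z : GrBar m) : z ∈ GrBarOn m Set.univ := by
  obtain ⟨x, rfl⟩ := proj_surjective z
  let g : Idx m → GrBarOn m Set.univ := fun I =>
    ⟨proj m (P I), Algebra.subset_adjoin ⟨I, fun _ => trivial, rfl⟩⟩
  let φ : Gr m →ₐ[ℂ] GrBarOn m Set.univ := grLift g
    (fun I hI => by
      rw [show g I = 1 from Subtype.ext (proj_eq_one hI)]
      exact isUnit_one)
    (fun i j => by
      apply Subtype.ext
      have h1 := pluckerExpr_map ((GrBarOn m Set.univ).val : GrBarOn m Set.univ →+* GrBar m) g i j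
      have h2 := pluckerExpr_map (proj m : Gr m →+* GrBar m) P i j
      rw [pluckerExpr_P, map_zero] at h2
      exact h1.trans h2.symm)
  have h : (GrBarOn m Set.univ).val.comp φ = proj m := gr_algHom_ext fun I => by
    change ((φ (P I) : GrBarOn m Set.univ) : GrBar m) = _
    rw [grLift_P]
  rw [← h]
  exact (φ x).2

lemma exists_shBar_mem (hm : 0 < m) (z : GrBar m) :
    ∃ T : ℕ, ∀ t : ℕ, T ≤ t → shBar m ((m * t : ℕ) : ℤ) z ∈ GrBarPlus m := by
  induction grBarOn_univ z using Algebra.adjoin_induction with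
  | mem y hy =>
    obtain ⟨I, -, rfl⟩ := hy
    refine ⟨∑ k, (1 - I k).toNat, fun t ht => ?_⟩
    rw [shBar_P]
    refine Algebra.subset_adjoin ⟨I.shift _, fun k => ?_, rfl⟩
    have := Finset.single_le_sum (f := fun k => (1 - I k).toNat) (fun _ _ => Nat.zero_le _)
      (Finset.mem_univ k)
    have h2 : t ≤ m * t := Nat.le_mul_of_pos_left t hm
    change (1 : ℤ) ≤ I k + ((m * t : ℕ) : ℤ)
    omega
  | algebraMap r =>
    refine ⟨0, fun t _ => ?_⟩
    rw [AlgHom.commutes]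
    exact Subalgebra.algebraMap_mem _ r
  | add y z _ _ h1 h2 =>
    obtain ⟨n1, h1⟩ := h1
    obtain ⟨n2, h2⟩ := h2
    refine ⟨max n1 n2, fun t ht => ?_⟩
    rw [map_add]
    exact add_mem (h1 t (le_trans (le_max_left _ _) ht)) (h2 t (le_trans (le_max_right _ _) ht))
  | mul y z _ _ h1 h2 =>
    obtain ⟨n1, h1⟩ := h1
    obtain ⟨n2, h2⟩ := h2
    refine ⟨max n1 n2, fun t ht => ?_⟩
    rw [map_mul]
    exact mul_mem (h1 t (le_trans (le_max_left _ _) ht)) (h2 t (le_trans (le_max_right _ _) ht))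

lemma grBarBraid_mem (hm : 1 < m) {i : ℕ} (h1 : 1 ≤ i) (h2 : i < m) {z : GrBar m}
    (hz : z ∈ GrBarPlus m) : grBarBraid hm i z ∈ GrBarPlus m := by
  suffices h : GrBarPlus m ≤ (GrBarPlus m).comap (grBarBraid hm i) from h hz
  refine Algebra.adjoin_le ?_
  rintro y ⟨I, hI, rfl⟩
  change grBarBraid hm i (proj m (P I)) ∈ GrBarPlus m
  rw [grBarBraid_proj]
  exact proj_mem (grBraid_mem hm (exchangeWithin_Ici h1 h2)
    (Algebra.subset_adjoin (Or.inl ⟨I, hI, rfl⟩)))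

/-- The endomorphism `σ_i` of `\bar Gr_m^+`. -/
def plusBraid (hm : 1 < m) {i : ℕ} (h : 1 ≤ i ∧ i < m) : GrBarPlus m →ₐ[ℂ] GrBarPlus m :=
  ((grBarBraid hm i).comp (GrBarPlus m).val).codRestrict (GrBarPlus m)
    (fun x => grBarBraid_mem hm h.1 h.2 x.2)

end Levels

/-! ### Functions on configurations -/

section Functions

variable {m : ℕ}

lemma kappaOver_eq_kappaSeq (i : ℕ) (v : ℤ → V m) : kappaOver i v = kappaSeq i v := by
  have h : ∀ j, exchVec v j = wVec v j := fun j => by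
    unfold exchVec exchCoeff wVec
    rw [Ring.inverse_eq_inv, inv_mul_eq_div]
    rfl
  funext k
  simp only [kappaOver, kappaSeq, h]

/-- The value at a configuration of the function given by an element of `Gr_m`. -/
def valueAt (hm : 1 < m) {N : ℕ} (v : Config m N) : Gr m →ₐ[ℂ] ℂ :=
  (Pi.evalAlgHom ℂ (fun _ : Config m N => ℂ) v).comp (toFun hm N)

lemma valueAt_P (hm : 1 < m) {N : ℕ} (v : Config m N) (I : Idx m) :
    valueAt hm v (P I) = seqMinor v.seq I := by
  change toFun hm N (P I) v = _
  unfold toFun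
  rw [grLift_P]
  rfl

/-- The endomorphism of `Gr_m` induces Fraser's action on functions. -/
lemma toFun_grBraid (hm : 1 < m) {N : ℕ} (hN : m ∣ N) (i : ℕ) (x : Gr m) :
    toFun hm N (grBraid hm i x) = fraser hm hN i (toFun hm N x) := by
  funext v
  have h : (valueAt hm v).comp (grBraid hm i) = valueAt hm (kappa hm hN i v) :=
    gr_algHom_ext fun I => by
      change valueAt hm v (grBraid hm i (P I)) = _
      rw [grBraid_P, valueAt_P]
      refine (map_seqMinor_kappaOver hm (valueAt hm v : Gr m →+* ℂ) (valueAt_P hm v) i I).trans ?_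
      rw [kappaOver_eq_kappaSeq]
      rfl
  exact congrArg (fun φ : Gr m →ₐ[ℂ] ℂ => φ x) h

/-! ### Faithfulness of evaluation on configurations -/

/-- Clearing denominators reduces injectivity of evaluation to polynomials in the P_I. -/
lemma exists_denominator {S : Set ℤ} {x : Gr m} (hx : x ∈ GrOn m S) :
    ∃ d : Gr m, IsUnit d ∧ d ∈ Algebra.adjoin ℂ {y | ∃ I : Idx m, (∀ k, I k ∈ S) ∧ y = P I} ∧
      d * x ∈ Algebra.adjoin ℂ {y | ∃ I : Idx m, (∀ k, I k ∈ S) ∧ y = P I} := by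
  induction hx using Algebra.adjoin_induction with
  | mem y hy =>
    rcases hy with h | ⟨J, hJ, hJS, hy⟩
    · exact ⟨1, isUnit_one, one_mem _, by rw [one_mul]; exact Algebra.subset_adjoin h⟩
    · exact ⟨P J, isUnit_P hJ, Algebra.subset_adjoin ⟨J, hJS, rfl⟩, by
        rw [mul_comm, hy]
        exact one_mem _⟩
  | algebraMap r =>
    exact ⟨1, isUnit_one, one_mem _, by rw [one_mul]; exact Subalgebra.algebraMap_mem _ r⟩
  | add y z _ _ h1 h2 =>
    obtain ⟨d1, hu1, hd1, h1⟩ := h1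
    obtain ⟨d2, hu2, hd2, h2⟩ := h2
    refine ⟨d1 * d2, hu1.mul hu2, mul_mem hd1 hd2, ?_⟩
    rw [show d1 * d2 * (y + z) = d2 * (d1 * y) + d1 * (d2 * z) by ring]
    exact add_mem (mul_mem hd2 h1) (mul_mem hd1 h2)
  | mul y z _ _ h1 h2 =>
    obtain ⟨d1, hu1, hd1, h1⟩ := h1
    obtain ⟨d2, hu2, hd2, h2⟩ := h2
    refine ⟨d1 * d2, hu1.mul hu2, mul_mem hd1 hd2, ?_⟩
    rw [show d1 * d2 * (y * z) = (d1 * y) * (d2 * z) by ring]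
    exact mul_mem h1 h2

/-- The `N`-periodic sequence of vectors whose coordinates are independent variables. -/
def genericSeq (m N : ℕ) : ℤ → Fin m → MvPolynomial (ZMod N × Fin m) ℂ :=
  fun k a => MvPolynomial.X ((k : ZMod N), a)

lemma seqMinor_genericSeq_map {N : ℕ} {A : Type*} [CommRing A]
    (φ : MvPolynomial (ZMod N × Fin m) ℂ →+* A) {v : ℤ → Fin m → A} {f : Fin m → ℤ}
    (h : ∀ a b, φ (MvPolynomial.X ((f a : ZMod N), b)) = v (f a) b) :
    φ (seqMinor (genericSeq m N) f) = seqMinor v f := by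
  rw [← seqMinor_mapSeq]
  unfold seqMinor
  congr 2
  funext a b
  exact h a b

/-- For m ≤ N the indices of a window are distinct modulo N, so its vectors can be specialized to
the standard basis. -/
lemma consecMinor_genericSeq_ne_zero {N : ℕ} (hN : m ≤ N) (k : ℤ) :
    consecMinor (genericSeq m N) k ≠ 0 := by
  intro h0
  let φ : MvPolynomial (ZMod N × Fin m) ℂ →+* ℂ :=
    MvPolynomial.eval fun c => if c.1 = ((k + (c.2 : ℕ) : ℤ) : ZMod N) then 1 else 0
  have h := seqMinor_genericSeq_map φ (f := fun a => k + (a : ℤ))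
    (v := fun l b => if l = k + (b : ℤ) then 1 else 0) (fun a b => by
      rw [MvPolynomial.eval_X]
      refine if_congr ?_ rfl rfl
      constructor
      · intro h
        rw [ZMod.intCast_eq_intCast_iff_dvd_sub] at h
        rw [show k + ((b : ℕ) : ℤ) - (k + (a : ℤ)) = (b : ℤ) - a by ring] at h
        have := Int.eq_zero_of_abs_lt_dvd h (abs_lt.mpr ⟨by omega, by omega⟩)
        omega
      · intro h
        rw [h])
  change φ (consecMinor (genericSeq m N) k) = _ at h
  rw [h0, map_zero] at h
  have h1 : seqMinor (fun (l : ℤ) (b : Fin m) => if l = k + (b : ℤ) then (1 : ℂ) else 0)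
      (fun a => k + (a : ℤ)) = 1 := by
    unfold seqMinor
    convert Matrix.det_one (n := Fin m) (R := ℂ)
    ext a b
    rw [Matrix.of_apply, Matrix.one_apply]
    refine if_congr ?_ rfl rfl
    rw [Fin.ext_iff, add_right_inj, Nat.cast_inj]
  rw [h1] at h
  exact zero_ne_one h

/-- A polynomial in `N` vectors that vanishes at all configurations is zero. -/
lemma eq_zero_of_forall_config {N : ℕ} [NeZero N] (hN : m ≤ N)
    {q : MvPolynomial (ZMod N × Fin m) ℂ}
    (hq : ∀ v : Config m N, ∀ e : ZMod N × Fin m → ℂ,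
      (∀ (k : ℤ) a, v.seq k a = e ((k : ZMod N), a)) → MvPolynomial.eval e q = 0) : q = 0 := by
  -- At each point either this product vanishes or the point is a configuration. Hence q times the
  -- product vanishes everywhere, and the polynomial ring is a domain.
  have hΔ : (∏ c : ZMod N, consecMinor (genericSeq m N) (c.val : ℤ)) ≠ 0 :=
    Finset.prod_ne_zero_iff.mpr fun c _ => consecMinor_genericSeq_ne_zero hN _
  refine (mul_eq_zero.mp (MvPolynomial.funext fun e => ?_ :
    q * (∏ c : ZMod N, consecMinor (genericSeq m N) (c.val : ℤ)) = 0)).resolve_right hΔ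
  rw [map_mul, map_zero, map_prod]
  by_cases h : ∃ c : ZMod N,
      MvPolynomial.eval e (consecMinor (genericSeq m N) (c.val : ℤ)) = 0
  · obtain ⟨c, hc⟩ := h
    rw [Finset.prod_eq_zero (Finset.mem_univ c) hc, mul_zero]
  push Not at h
  let w : ℤ → V m := fun k a => e ((k : ZMod N), a)
  have hw : ∀ k : ℤ, MvPolynomial.eval e (consecMinor (genericSeq m N) k) = consecMinor w k :=
    fun k => seqMinor_genericSeq_map (MvPolynomial.eval e) fun a b => by rw [MvPolynomial.eval_X]
  have hgen : ConsecGeneric w := fun k => by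
    have h1 := h (k : ZMod N)
    have h2 : consecMinor (genericSeq m N) (((k : ZMod N).val : ℕ) : ℤ) =
        consecMinor (genericSeq m N) k := by
      unfold consecMinor seqMinor
      congr 2
      funext a b
      simp [genericSeq]
    rw [h2, hw] at h1
    exact Matrix.linearIndependent_rows_iff_isUnit.mpr
      ((Matrix.isUnit_iff_isUnit_det _).mpr h1.isUnit)
  rw [hq ⟨w, fun k => by funext a; simp [w], hgen⟩ e fun k a => rfl, zero_mul]

/-- `Gr_m^N` is identified with an algebra of functions on configurations. -/
lemma eq_zero_of_toFun_eq_zero (hm : 1 < m) {N : ℕ} (hN : m ≤ N) {x : Gr m} (hx : x ∈ GrN m N)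
    (h0 : toFun hm N x = 0) : x = 0 := by
  have : NeZero N := ⟨by omega⟩
  obtain ⟨d, hd, -, hdx⟩ := exists_denominator hx
  rw [← hd.mul_right_eq_zero]
  have h0' : ∀ v : Config m N, valueAt hm v (d * x) = 0 := fun v => by
    have h1 : valueAt hm v x = 0 := congrFun h0 v
    rw [map_mul, h1, mul_zero]
  generalize d * x = y at hdx h0'
  let J := {I : Idx m // ∀ k, I k ∈ Set.Icc 1 (N : ℤ)}
  have hrange : {y | ∃ I : Idx m, (∀ k, I k ∈ Set.Icc 1 (N : ℤ)) ∧ y = P I} =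
      Set.range fun I : J => P I.1 := by
    ext z
    constructor
    · rintro ⟨I, hI, rfl⟩
      exact ⟨⟨I, hI⟩, rfl⟩
    · rintro ⟨I, rfl⟩
      exact ⟨I.1, I.2, rfl⟩
  rw [hrange, Algebra.adjoin_range_eq_range_aeval] at hdx
  obtain ⟨Q, rfl⟩ := hdx
  change MvPolynomial.aeval (fun I : J => P I.1) Q = 0
  have haeval : ∀ {A B : Type} [CommRing A] [CommRing B] [Algebra ℂ A] [Algebra ℂ B]
      (φ : A →ₐ[ℂ] B) (g : J → A), φ (MvPolynomial.aeval g Q) =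
        MvPolynomial.aeval (fun I => φ (g I)) Q := fun φ g => by
    have : φ.comp (MvPolynomial.aeval g) = MvPolynomial.aeval (fun I => φ (g I)) :=
      MvPolynomial.algHom_ext fun I => by simp
    rw [← this]
    rfl
  set q : MvPolynomial (ZMod N × Fin m) ℂ :=
    MvPolynomial.aeval (fun I : J => seqMinor (genericSeq m N) I.1) Q with hqdef
  have hq : q = 0 := eq_zero_of_forall_config hN fun v e he => by
    have h1 := h0' v
    change valueAt hm v (MvPolynomial.aeval (fun I : J => P I.1) Q) = 0 at h1
    rw [haeval] at h1
    have h2 := haeval (MvPolynomial.aeval e) (fun I : J => seqMinor (genericSeq m N) I.1)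
    change MvPolynomial.eval e q = _ at h2
    rw [h2, ← h1]
    congr 2
    funext I
    rw [valueAt_P]
    refine seqMinor_genericSeq_map (MvPolynomial.eval e) fun a b => ?_
    rw [MvPolynomial.eval_X, he]
  -- Substituting the universal vectors turns the generic minors back into the P_I, so the
  -- polynomial identity q = 0 gives the claim in `Gr m`. The two shifts by 1 select the
  -- representative in [1, N] of a class modulo N.
  let ψ : MvPolynomial (ZMod N × Fin m) ℂ →ₐ[ℂ] Gr m :=
    MvPolynomial.aeval fun c => univSeq m (((c.1 - 1).val : ℤ) + 1) c.2
  have hψ := haeval ψ (fun I : J => seqMinor (genericSeq m N) I.1)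
  rw [← hqdef, hq, map_zero] at hψ
  rw [hψ]
  congr 2
  funext I
  rw [← seqMinor_univSeq_coe (by omega) I.1]
  refine (seqMinor_genericSeq_map (ψ : MvPolynomial (ZMod N × Fin m) ℂ →+* Gr m)
    fun a b => ?_).symm
  change MvPolynomial.aeval _ (MvPolynomial.X _) = _
  rw [MvPolynomial.aeval_X]
  congr 1
  obtain ⟨h1, h2⟩ := I.2 a
  have h3 : ((I.1 a : ℤ) : ZMod N) - 1 = ((I.1 a - 1 : ℤ) : ZMod N) := by push_cast; rfl
  change (((((I.1 a : ℤ) : ZMod N) - 1).val : ℕ) : ℤ) + 1 = I.1 a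
  rw [h3, ZMod.val_intCast, Int.emod_eq_of_lt (by omega) (by omega)]
  ring

end Functions

end

end InfGrass

/-! ### The proposition -/

theorem proposition4p5 (m : ℕ) (hm : 1 < m) :
    ∃ σ : ℕ → (InfGrass.GrBarPlus m →ₐ[ℂ] InfGrass.GrBarPlus m),
      -- the braid relations
      (∀ i, 1 ≤ i → i + 1 < m →
        ((σ i).comp (σ (i + 1))).comp (σ i) = ((σ (i + 1)).comp (σ i)).comp (σ (i + 1))) ∧
      (∀ i j, 1 ≤ i → i + 1 < j → j < m → (σ i).comp (σ j) = (σ j).comp (σ i)) ∧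
      -- commutation with the shift by `m`
      (∀ i, 1 ≤ i → i < m →
        (σ i).comp (InfGrass.shPlus m m) = (InfGrass.shPlus m m).comp (σ i)) ∧
      -- compatibility with the action for `(m, N')`, for all large `N'` divisible by `m`:
      -- the image of `x` under that action is an element `y` of `Gr_m^{N'}`, and
      -- `σ_i (p x) = p y`
      (∀ i, 1 ≤ i → i < m → ∀ x : InfGrass.GrPlus m, ∃ N : ℕ, 0 < N ∧
        ∀ N' : ℕ, N ≤ N' → ∀ hN' : m ∣ N',
          (x : InfGrass.Gr m) ∈ InfGrass.GrN m N' ∧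
          (∃ y : InfGrass.GrPlus m, (y : InfGrass.Gr m) ∈ InfGrass.GrN m N' ∧
            InfGrass.fraser hm hN' i (InfGrass.toFun hm N' x) = InfGrass.toFun hm N' y) ∧
          (∀ y : InfGrass.GrPlus m, (y : InfGrass.Gr m) ∈ InfGrass.GrN m N' →
            InfGrass.fraser hm hN' i (InfGrass.toFun hm N' x) = InfGrass.toFun hm N' y →
            σ i (InfGrass.projPlus m x) = InfGrass.projPlus m y)) ∧
      -- extension to the whole of `\bar Gr_m`
      (∃ τ : ℕ → (InfGrass.GrBar m →ₐ[ℂ] InfGrass.GrBar m),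
        (∀ i, 1 ≤ i → i < m →
          (∀ z : InfGrass.GrBarPlus m, τ i z = (σ i z : InfGrass.GrBar m)) ∧
          (∀ z : InfGrass.GrBar m, ∃ T : ℕ, ∀ t : ℕ, T ≤ t →
            ∃ hz : InfGrass.shBar m ((m * t : ℕ) : ℤ) z ∈ InfGrass.GrBarPlus m,
              τ i z = InfGrass.shBar m (-((m * t : ℕ) : ℤ))
                (σ i ⟨InfGrass.shBar m ((m * t : ℕ) : ℤ) z, hz⟩ : InfGrass.GrBar m)) ∧
          (τ i).comp (InfGrass.shBar m m) = (InfGrass.shBar m m).comp (τ i)) ∧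
        (∀ i, 1 ≤ i → i + 1 < m →
          ((τ i).comp (τ (i + 1))).comp (τ i) =
            ((τ (i + 1)).comp (τ i)).comp (τ (i + 1))) ∧
        (∀ i j, 1 ≤ i → i + 1 < j → j < m →
          (τ i).comp (τ j) = (τ j).comp (τ i))) := by
  classical
  -- Outside 1 ≤ i < m the choice is arbitrary, since preservation of the indices ≥ 1 is known only
  -- in that range.
  refine ⟨fun i => if h : 1 ≤ i ∧ i < m then InfGrass.plusBraid hm h else AlgHom.id ℂ _,
    ?_, ?_, ?_, ?_, fun i => InfGrass.grBarBraid hm i, ?_, ?_, ?_⟩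
  · intro i h1 h2
    dsimp only
    rw [dif_pos (show 1 ≤ i ∧ i < m by omega), dif_pos (show 1 ≤ i + 1 ∧ i + 1 < m by omega)]
    exact AlgHom.ext fun z => Subtype.ext (InfGrass.grBarBraid_braid (m := m) (by omega) i z.1)
  · intro i j h1 h2 h3
    dsimp only
    rw [dif_pos (show 1 ≤ i ∧ i < m by omega), dif_pos (show 1 ≤ j ∧ j < m by omega)]
    exact AlgHom.ext fun z => Subtype.ext (InfGrass.grBarBraid_comm hm h1 h2 h3 z.1)
  · intro i h1 h2
    dsimp only
    rw [dif_pos ⟨h1, h2⟩]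
    exact AlgHom.ext fun z => Subtype.ext (InfGrass.grBarBraid_shBar hm i z)
  · intro i h1 h2 x
    obtain ⟨n, hn⟩ := InfGrass.exists_mem_GrN x.2
    -- Exchanges at places up to n involve vectors up to n + m at most, so there is no wrap-around.
    refine ⟨n + m, by omega, fun N hN hmN => ?_⟩
    have hmem : InfGrass.grBraid hm i x ∈ InfGrass.GrN m N :=
      InfGrass.grBraid_mem hm (InfGrass.exchangeWithin_Icc h1 h2 hN) hn
    refine ⟨InfGrass.GrOn_mono (Set.Icc_subset_Icc_right (by omega)) hn,
      ⟨⟨InfGrass.grBraid hm i x, InfGrass.grBraid_mem hm (InfGrass.exchangeWithin_Ici h1 h2) x.2⟩,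
        hmem, (InfGrass.toFun_grBraid hm hmN i x).symm⟩, fun y hy hxy => ?_⟩
    -- Any y on level N representing Fraser's function is this image, by injectivity of evaluation;
    -- hence the projected value does not depend on y.
    have hzero : InfGrass.grBraid hm i x - y = 0 :=
      InfGrass.eq_zero_of_toFun_eq_zero hm (by omega) (sub_mem hmem hy) (by
        rw [map_sub, InfGrass.toFun_grBraid hm hmN, hxy, sub_self])
    dsimp only
    rw [dif_pos ⟨h1, h2⟩]
    refine Subtype.ext ?_
    change InfGrass.proj m (InfGrass.grBraid hm i x) = InfGrass.proj m y
    rw [sub_eq_zero.mp hzero]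
  · intro i h1 h2
    refine ⟨fun z => ?_, fun z => ?_, AlgHom.ext fun z => InfGrass.grBarBraid_shBar hm i z⟩
    · dsimp only
      rw [dif_pos ⟨h1, h2⟩]
      rfl
    · obtain ⟨T, hT⟩ := InfGrass.exists_shBar_mem (m := m) (by omega) z
      refine ⟨T, fun t ht => ⟨hT t ht, ?_⟩⟩
      dsimp only
      rw [dif_pos ⟨h1, h2⟩]
      change _ = InfGrass.shBar m _ (InfGrass.grBarBraid hm i (InfGrass.shBar m _ z))
      rw [InfGrass.grBarBraid_shBar_mul, InfGrass.shBar_shBar, add_neg_cancel, InfGrass.shBar_zero]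
  · intro i h1 h2
    exact AlgHom.ext fun z => InfGrass.grBarBraid_braid (by omega) i z
  · intro i j h1 h2 h3
    exact AlgHom.ext fun z => InfGrass.grBarBraid_comm hm h1 h2 h3 z
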